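/- **Setting.** Let $C,A_1,\dots,A_m\in\mathbb R^{n\times n}$ be symmetric with $A_1,\dots,A_m$ linearly independent, and let $b\in\mathbb R^m$; these are the data of the semidefinite program $\max\langle C,X\rangle$ subject to $X\succeq 0$, $\langle A_i,X\rangle=b_i$ $(i\in[m])$. For $y\in\mathbb R^m$, $\eta>0$ and $M\in\mathbb R^{n\times n}$ put $$S(y)=\sum_{i=1}^m y_iA_i-C,\quad g_\eta(y)_j=\eta b_j-\mathrm{tr}[S(y)^{-1}A_j],\quad H(M)_{j,k}=\mathrm{tr}[M^{-1}A_jM^{-1}A_k],\quad H(y)=H(S(y)).$$ **The algorithm.** Let $0<\delta\le 0.1$, $0<\epsilon_N\le 0.1$, $\epsilon_S=0.01$ and $T=\left\lceil\frac{40}{\epsilon_N}\sqrt n\,\log(n/\delta)\right\rceil$. The interior point method starts from a parameter $\eta>0$ and a vector $y$, with $\widetilde S=S(y)$, and in each of the iterations $1,\dots,T$ it performs $$\eta\leftarrow\eta\Big(1+\frac{\epsilon_N}{20\sqrt n}\Big),\qquad y\leftarrow y-H(\widetilde S)^{-1}g_\eta(y),\qquad \widetilde S\leftarrow\textsc{ApproxSlackUpdate}(S(y),\widetilde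 S).$$ $\textsc{ApproxSlackUpdate}(S_{\rm new},\widetilde S)$ takes a spectral decomposition $S_{\rm new}^{-1/2}\widetilde S S_{\rm new}^{-1/2}-I=U\,\mathrm{diag}(\lambda)\,U^\top$ and a permutation $\pi$ with $|\lambda_{\pi(1)}|\ge\dots\ge|\lambda_{\pi(n)}|$ (any valid choices; put $\lambda_{\pi(j)}=0$ for $j>n$). If $|\lambda_{\pi(1)}|\le\epsilon_S$, it returns $\widetilde S$. Otherwise let $r\ge1$ be the least integer with $|\lambda_{\pi(2r)}|\le\epsilon_S$ and $|\lambda_{\pi(2r)}|\le(1-1/\log n)|\lambda_{\pi(r)}|$; let $\lambda_{\rm new}$ be $\lambda$ with the entries $\pi(1),\dots,\pi(2r)$ replaced by $0$; it returns $\widetilde S+S_{\rm new}^{1/2}\,U\,\mathrm{diag}(\lambda_{\rm new}-\lambda)\,U^\top S_{\rm new}^{1/2}$. Let $r_0=n$ and, for $1\le i\le T$, let $r_i$ be the rank of the change of $\widetilde S$ in iteration $i$. **Theorem (rank inequality).** There is a universal constant $K>0$ such that the following two statements hold. 1. Let $n\ge2$, and suppose that the method is started at some $\eta>0$ and a strictly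 dual feasible $y$ (that is, $S(y)\succ0$) close to the central path in the sense that $g_\eta(y)^\top H(y)^{-1}g_\eta(y)\le\epsilon_N^2$. Then $$\sum_{i=0}^T\sqrt{r_i}\le K\,T\log^{1.5}n .$$ 2. Let $R,L>0$ with $\|C\|_{\rm op}\le L$, and suppose $\delta\sqrt n\le\epsilon_N$. Consider the modified program of size $n+2$ with $m+1$ constraints given by $\overline A_i=\mathrm{diag}(A_i,0,\tfrac{b_i}{R}-\mathrm{tr}[A_i])$ for $i\in[m]$, $\overline A_{m+1}=\mathrm{diag}(I_n,1,0)$, $\overline b=(\tfrac1Rb,\,n+1)$, $\overline C=\mathrm{diag}(\tfrac{\delta}{L}C,0,-1)$. Suppose that the method is run on this program (so with $n+2$ in place of $n$ everywhere, in particular in $T$ and $r_0$) from $\overline y=(0,\dots,0,1)$ and $\eta=1$. Then $$\sum_{i=0}^T\sqrt{r_i}\le K\,T\log^{1.5}(n+2) .$$ -/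

import Mathlib

open scoped Matrix MatrixOrder

noncomputable section

/-- Data of a semidefinite program with an `n × n` matrix variable and `m` constraints:
maximise `⟨C, X⟩` subject to `X ⪰ 0` and `⟨A i, X⟩ = b i` for all `i`. -/
structure SDPData (n m : ℕ) where
  C : Matrix (Fin n) (Fin n) ℝ
  A : Fin m → Matrix (Fin n) (Fin n) ℝ
  b : Fin m → ℝ
  C_symm : C.IsSymm
  A_symm : ∀ i, (A i).IsSymm

namespace SDPData

variable {n m : ℕ}

/-- There are no redundant constraints: the constraint matrices are linearly independent. -/
def NoRedundantConstraints (P : SDPData n m) : Prop := LinearIndependent ℝ P.A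

/-- The slack matrix `S(y) = ∑ i, y i • A i - C` of the dual program
`min b ⬝ y` subject to `S(y) ⪰ 0`. -/
def slack (P : SDPData n m) (y : Fin m → ℝ) : Matrix (Fin n) (Fin n) ℝ :=
  ∑ i, y i • P.A i - P.C

/-- The `m × m` matrix with entries `tr (M⁻¹ A j M⁻¹ A k)`. For `M = S(y)` it is the Hessian `H(y)`
of the log barrier; for `M` an approximate slack matrix it is the approximate Hessian. -/
def hessian (P : SDPData n m) (M : Matrix (Fin n) (Fin n) ℝ) : Matrix (Fin m) (Fin m) ℝ :=
  Matrix.of fun j k => (M⁻¹ * P.A j * M⁻¹ * P.A k).trace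

/-- The gradient at `y` of the penalised objective `η * (b ⬝ y) - log det S(y)`. -/
def gradient (P : SDPData n m) (η : ℝ) (y : Fin m → ℝ) : Fin m → ℝ :=
  fun j => η * P.b j - ((P.slack y)⁻¹ * P.A j).trace

/-- `y` is strictly dual feasible, and it is close to the dual central path at `η`: the Newton step
at `y` has size at most `εN`, that is, `g_η(y)ᵀ H(y)⁻¹ g_η(y) ≤ εN ^ 2`. -/
def NearCentralPath (P : SDPData n m) (εN η : ℝ) (y : Fin m → ℝ) : Prop :=
  (P.slack y).PosDef ∧
    P.gradient η y ⬝ᵥ ((P.hessian (P.slack y))⁻¹ *ᵥ P.gradient η y) ≤ εN ^ 2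

end SDPData

/-- The spectral approximation constant `ε_S`. -/
def epsS : ℝ := 1 / 100

/-- `|λ_{π(j)}|` for a one-based position `j`, with the convention that it is `0` when `j` is not
one of the positions `1, …, n`. -/
def absEig {n : ℕ} (lam : Fin n → ℝ) (π : Equiv.Perm (Fin n)) (j : ℕ) : ℝ :=
  if h : 1 ≤ j ∧ j ≤ n then |lam (π ⟨j - 1, by omega⟩)| else 0

/-- The guard of the while loop that determines `r`. -/
def LoopGuard {n : ℕ} (lam : Fin n → ℝ) (π : Equiv.Perm (Fin n)) (r : ℕ) : Prop :=
  epsS < absEig lam π (2 * r) ∨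
    (1 - 1 / Real.log n) * absEig lam π r < absEig lam π (2 * r)

/-- The vector `λ_new`: the entries of `λ` at the sorted positions `1, …, 2r` are set to `0`. -/
def newEig {n : ℕ} (lam : Fin n → ℝ) (π : Equiv.Perm (Fin n)) (r : ℕ) : Fin n → ℝ :=
  fun k => if (π.symm k : ℕ) + 1 ≤ 2 * r then 0 else lam k

/-- `StNew` is a possible output of the procedure `ApproxSlackUpdate` on the input `(Snew, St)`.
The spectral decomposition `Z_mid = U diag(lam) Uᵀ` and the sorting permutation `π` may be any valid
ones. The while loop starts at `r = 1` and increments `r` as long as its guard holds, so it ends at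
the least `r ≥ 1` at which the guard fails. -/
def IsApproxSlackUpdate {n : ℕ} (Snew St StNew : Matrix (Fin n) (Fin n) ℝ) : Prop :=
  ∃ U ∈ Matrix.orthogonalGroup (Fin n) ℝ, ∃ (lam : Fin n → ℝ) (π : Equiv.Perm (Fin n)),
    (CFC.sqrt Snew)⁻¹ * St * (CFC.sqrt Snew)⁻¹ - 1 = U * Matrix.diagonal lam * Uᵀ ∧
    Antitone (fun i : Fin n => |lam (π i)|) ∧
    ((absEig lam π 1 ≤ epsS ∧ StNew = St) ∨
      (epsS < absEig lam π 1 ∧ ∃ r : ℕ, IsLeast {r : ℕ | 1 ≤ r ∧ ¬ LoopGuard lam π r} r ∧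
        StNew = St + CFC.sqrt Snew * U * Matrix.diagonal (newEig lam π r - lam) * Uᵀ
          * CFC.sqrt Snew))

/-- The variables that the interior point method carries from one iteration to the next: the
parameter `η`, the dual solution `y` and the approximate slack matrix. The true slack matrix is
always `S(y)`. -/
structure IPMState (n m : ℕ) where
  η : ℝ
  y : Fin m → ℝ
  St : Matrix (Fin n) (Fin n) ℝ

/-- `s'` is a possible result of one iteration of the interior point method from `s`: increase `η`,
take the Newton step with the approximate Hessian, update the approximate slack matrix. -/
structure IPMStep {n m : ℕ} (P : SDPData n m) (εN : ℝ) (s s' : IPMState n m) : Prop where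
  eta_new : s'.η = s.η * (1 + εN / (20 * √(n : ℝ)))
  y_new : s'.y = s.y - (P.hessian s.St)⁻¹ *ᵥ P.gradient s'.η s.y
  St_new : IsApproxSlackUpdate (P.slack s'.y) s.St s'.St

/-- The number `T` of iterations, `(40 / εN) √n log (n / δ)` rounded up. -/
def numIterations (n : ℕ) (δ εN : ℝ) : ℕ :=
  ⌈40 / εN * √(n : ℝ) * Real.log (n / δ)⌉₊

/-- `s 0, …, s T` are the successive states in a run of the interior point method that starts at
the parameter `η₀` and the dual solution `y₀`, with the approximate slack matrix equal to the
true one. -/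
structure IsIPMRun {n m : ℕ} (P : SDPData n m) (δ εN η₀ : ℝ) (y₀ : Fin m → ℝ)
    (s : ℕ → IPMState n m) : Prop where
  eta_init : (s 0).η = η₀
  y_init : (s 0).y = y₀
  St_init : (s 0).St = P.slack y₀
  step : ∀ t < numIterations n δ εN, IPMStep P εN (s t) (s (t + 1))

/-- `r_0 = n`, and for `i ≥ 1`, `r_i` is the rank of the update to the approximate slack matrix in
iteration `i`. -/
def updateRank {n m : ℕ} (s : ℕ → IPMState n m) : ℕ → ℕ
  | 0 => n
  | i + 1 => ((s (i + 1)).St - (s i).St).rank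

/-- The block diagonal matrix `diag(M, u, v)` of size `n + 2`. -/
def blockDiag {n : ℕ} (M : Matrix (Fin n) (Fin n) ℝ) (u v : ℝ) :
    Matrix (Fin (n + 2)) (Fin (n + 2)) ℝ :=
  Matrix.reindex finSumFinEquiv finSumFinEquiv
    (Matrix.fromBlocks M 0 0 (Matrix.diagonal ![u, v]))

lemma blockDiag_isSymm {n : ℕ} {M : Matrix (Fin n) (Fin n) ℝ} (hM : M.IsSymm) (u v : ℝ) :
    (blockDiag M u v).IsSymm := by
  unfold blockDiag Matrix.IsSymm
  rw [Matrix.transpose_reindex, Matrix.fromBlocks_transpose, hM.eq]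
  simp

/-- The modified semidefinite program, of size `n + 2` and with `m + 1` constraints, on which the
interior point method is run in order to solve `P`. -/
def SDPData.modified {n m : ℕ} (P : SDPData n m) (δ R L : ℝ) : SDPData (n + 2) (m + 1) where
  C := blockDiag ((δ / L) • P.C) 0 (-1)
  A := Fin.snoc (α := fun _ => Matrix (Fin (n + 2)) (Fin (n + 2)) ℝ)
    (fun i => blockDiag (P.A i) 0 (P.b i / R - (P.A i).trace)) (blockDiag 1 1 0)
  b := Fin.snoc (α := fun _ => ℝ) (fun i => P.b i / R) (n + 1)
  C_symm := blockDiag_isSymm (P.C_symm.smul _) _ _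
  A_symm := by
    intro i
    refine Fin.lastCases ?_ (fun j => ?_) i
    · rw [Fin.snoc_last]; exact blockDiag_isSymm Matrix.isSymm_one _ _
    · rw [Fin.snoc_castSucc]; exact blockDiag_isSymm (P.A_symm j) _ _

/-- The initial dual solution `(0, …, 0, 1)` of the modified program. -/
def modifiedStart (m : ℕ) : Fin (m + 1) → ℝ := Fin.snoc (α := fun _ => ℝ) (fun _ => 0) 1

end

/-! The proof is an amortised analysis. Let `λ` be the spectrum of `S^{-1/2} S̃ S^{-1/2} - I`, where
`S` is the true slack matrix and `S̃` the approximate one, and let the potential be the sum of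
`|λ|_{[i]} / √i` over the absolute values in decreasing order. It is zero at the start and never
negative.

Moving `S` raises the potential by at most `√(∑ 1/i) ≤ √(1 + log n)` per iteration. While all `|λ_i|
≤ 1/100`, a Newton step with the approximate Hessian moves `S` by at most 0.11 in its local
Frobenius norm and restores the Newton decrement to at most `εN` (`newton_step`). Such a move
changes the spectrum, after a suitable rotation, by a matrix of Frobenius norm at most 1
(`potential_le_of_move`). The potential is Lipschitz by Birkhoff's theorem and Cauchy–Schwarz
(`potential_le_add_frob`).

An update with parameter `r` has rank at most `2r` and lowers the potential by a constant times `√r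
/ log n` (`potential_newEig_add_le`). The failed guard gives a gap of `|λ_{π(r)}| / log n` between
positions `r` and `2r`; the guards that held before keep `|λ_{π(r)}|` above a constant, since only
`O(log n)` doublings lead from 1 to `r`; and the first `r` weights sum to at least `√r`.

Telescoping gives `∑ √r_i = O(log n) · T √(1 + log n)`. The term `r_0 = n` is absorbed because `T`
is at least of order `√n`. The modified program reduces to this case since its start is near the
central path. -/

noncomputable section

/-! ### Frobenius norm inequalities -/

section Frobenius

variable {n : ℕ}

/-- The Frobenius norm of a real square matrix. -/
def frob (X : Matrix (Fin n) (Fin n) ℝ) : ℝ := √(∑ i, ∑ j, X i j ^ 2)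

lemma frob_nonneg (X : Matrix (Fin n) (Fin n) ℝ) : 0 ≤ frob X := Real.sqrt_nonneg _

lemma frob_sq (X : Matrix (Fin n) (Fin n) ℝ) : frob X ^ 2 = ∑ i, ∑ j, X i j ^ 2 :=
  Real.sq_sqrt (Finset.sum_nonneg fun _ _ => Finset.sum_nonneg fun _ _ => sq_nonneg _)

section

open scoped Matrix.Norms.Frobenius

lemma frob_eq_norm (X : Matrix (Fin n) (Fin n) ℝ) : frob X = ‖X‖ := by
  rw [Matrix.frobenius_norm_def, frob, Real.sqrt_eq_rpow]
  simp

lemma frob_add_le (X Y : Matrix (Fin n) (Fin n) ℝ) : frob (X + Y) ≤ frob X + frob Y := by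
  simpa only [frob_eq_norm] using norm_add_le X Y

lemma frob_mul_le (X Y : Matrix (Fin n) (Fin n) ℝ) : frob (X * Y) ≤ frob X * frob Y := by
  simpa only [frob_eq_norm] using norm_mul_le X Y

lemma frob_neg (X : Matrix (Fin n) (Fin n) ℝ) : frob (-X) = frob X := by
  simpa only [frob_eq_norm] using norm_neg X

lemma frob_transpose (X : Matrix (Fin n) (Fin n) ℝ) : frob Xᵀ = frob X := by
  simpa only [frob_eq_norm] using Matrix.frobenius_norm_transpose X

lemma frob_eq_zero {X : Matrix (Fin n) (Fin n) ℝ} (h : frob X = 0) : X = 0 := by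
  rw [frob_eq_norm] at h
  exact norm_eq_zero.mp h

end

lemma frob_sq_eq_trace (X : Matrix (Fin n) (Fin n) ℝ) : frob X ^ 2 = (Xᵀ * X).trace := by
  rw [frob_sq, Finset.sum_comm]
  simp [Matrix.trace, Matrix.mul_apply, sq]

lemma frob_one : frob (1 : Matrix (Fin n) (Fin n) ℝ) = √n := by
  rw [frob]
  congr 1
  simp [Matrix.one_apply]

lemma frob_mul_left {U : Matrix (Fin n) (Fin n) ℝ} (hU : Uᵀ * U = 1)
    (X : Matrix (Fin n) (Fin n) ℝ) : frob (U * X) = frob X := by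
  rw [← sq_eq_sq₀ (frob_nonneg _) (frob_nonneg _), frob_sq_eq_trace, frob_sq_eq_trace,
    Matrix.transpose_mul, Matrix.mul_assoc, ← Matrix.mul_assoc Uᵀ, hU, Matrix.one_mul]

lemma frob_mul_right {U : Matrix (Fin n) (Fin n) ℝ} (hU : U * Uᵀ = 1)
    (X : Matrix (Fin n) (Fin n) ℝ) : frob (X * U) = frob X := by
  rw [← frob_transpose, Matrix.transpose_mul, frob_mul_left (by simpa using hU), frob_transpose]

lemma abs_trace_mul_le (X Y : Matrix (Fin n) (Fin n) ℝ) :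
    |(X * Y).trace| ≤ frob X * frob Y := by
  have h : (X * Y).trace ^ 2 ≤ frob X ^ 2 * frob Y ^ 2 := by
    rw [← frob_transpose Y, frob_sq, frob_sq]
    have := Finset.sum_mul_sq_le_sq_mul_sq (Finset.univ : Finset (Fin n × Fin n))
      (fun p => X p.1 p.2) (fun p => Y p.2 p.1)
    simpa [Fintype.sum_prod_type, Matrix.trace, Matrix.mul_apply] using this
  rw [← mul_pow] at h
  exact abs_le_of_sq_le_sq h (mul_nonneg (frob_nonneg _) (frob_nonneg _))

lemma frob_le_of_abs_le {X Y : Matrix (Fin n) (Fin n) ℝ} {c : ℝ} (hc : 0 ≤ c)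
    (h : ∀ i j, |X i j| ≤ c * |Y i j|) : frob X ≤ c * frob Y := by
  rw [← sq_le_sq₀ (frob_nonneg _) (mul_nonneg hc (frob_nonneg _)), mul_pow, frob_sq, frob_sq,
    Finset.mul_sum]
  refine Finset.sum_le_sum fun i _ => ?_
  rw [Finset.mul_sum]
  refine Finset.sum_le_sum fun j _ => ?_
  rw [← mul_pow, ← sq_abs (X i j), ← sq_abs (c * Y i j), abs_mul, abs_of_nonneg hc]
  exact pow_le_pow_left₀ (abs_nonneg _) (h i j) 2

lemma dotProduct_mulVec_le_frob (X : Matrix (Fin n) (Fin n) ℝ) (z : Fin n → ℝ) :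
    |z ⬝ᵥ (X *ᵥ z)| ≤ frob X * (z ⬝ᵥ z) := by
  have h : (z ⬝ᵥ (X *ᵥ z)) ^ 2 ≤ frob X ^ 2 * (z ⬝ᵥ z) ^ 2 := by
    have := Finset.sum_mul_sq_le_sq_mul_sq (Finset.univ : Finset (Fin n × Fin n))
      (fun p => X p.1 p.2) (fun p => z p.1 * z p.2)
    simp only [Fintype.sum_prod_type] at this
    have h1 : z ⬝ᵥ (X *ᵥ z) = ∑ i, ∑ j, X i j * (z i * z j) := by
      simp only [dotProduct, Matrix.mulVec, Finset.mul_sum]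
      exact Finset.sum_congr rfl fun i _ => Finset.sum_congr rfl fun j _ => by ring
    have h2 : (z ⬝ᵥ z) ^ 2 = ∑ i, ∑ j, (z i * z j) ^ 2 := by
      rw [sq, dotProduct, Finset.sum_mul_sum]
      exact Finset.sum_congr rfl fun i _ => Finset.sum_congr rfl fun j _ => by ring
    rw [frob_sq, h1, h2]
    exact this
  rw [← mul_pow] at h
  exact abs_le_of_sq_le_sq h (mul_nonneg (frob_nonneg _)
    (Finset.sum_nonneg fun i _ => mul_self_nonneg _))

end Frobenius

/-! ### Symmetric square roots and congruence -/

/-- `Q` is an invertible symmetric square root of `S`, with inverse `R`. -/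
structure SymmSqrt {n : ℕ} (S Q R : Matrix (Fin n) (Fin n) ℝ) : Prop where
  symm : Qᵀ = Q
  symm_inv : Rᵀ = R
  mul_self : Q * Q = S
  mul_inv : Q * R = 1
  inv_mul : R * Q = 1

namespace SymmSqrt

variable {n : ℕ} {S Q R : Matrix (Fin n) (Fin n) ℝ}

lemma of_posDef (hS : S.PosDef) : SymmSqrt S (CFC.sqrt S) (CFC.sqrt S)⁻¹ := by
  have hmul : CFC.sqrt S * CFC.sqrt S = S := CFC.sqrt_mul_sqrt_self S hS.posSemidef.nonneg
  have hsymm : (CFC.sqrt S)ᵀ = CFC.sqrt S := by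
    have := (Matrix.nonneg_iff_posSemidef.mp (CFC.sqrt_nonneg S)).isHermitian
    simpa [Matrix.IsHermitian, Matrix.conjTranspose_eq_transpose_of_trivial] using this
  have hdet : IsUnit (CFC.sqrt S).det := by
    have h := (Matrix.isUnit_iff_isUnit_det _).mp hS.isUnit
    rw [← hmul, Matrix.det_mul] at h
    exact isUnit_of_mul_isUnit_left h
  refine ⟨hsymm, ?_, hmul, Matrix.mul_nonsing_inv _ hdet, Matrix.nonsing_inv_mul _ hdet⟩
  rw [Matrix.transpose_nonsing_inv, hsymm]

lemma inv_eq (h : SymmSqrt S Q R) : S⁻¹ = R * R := by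
  apply Matrix.inv_eq_right_inv
  rw [← h.mul_self, Matrix.mul_assoc, ← Matrix.mul_assoc Q R R, h.mul_inv, Matrix.one_mul,
    h.mul_inv]

lemma inv_mul_cancel (h : SymmSqrt S Q R) (X : Matrix (Fin n) (Fin n) ℝ) : R * (Q * X) = X := by
  rw [← Matrix.mul_assoc, h.inv_mul, Matrix.one_mul]

lemma mul_inv_cancel (h : SymmSqrt S Q R) (X : Matrix (Fin n) (Fin n) ℝ) : Q * (R * X) = X := by
  rw [← Matrix.mul_assoc, h.mul_inv, Matrix.one_mul]

lemma conj_inv_conj (h : SymmSqrt S Q R) (X : Matrix (Fin n) (Fin n) ℝ) :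
    Q * (R * X * R) * Q = X := by
  rw [Matrix.mul_assoc R, h.mul_inv_cancel, Matrix.mul_assoc, h.inv_mul, Matrix.mul_one]

lemma inv_conj_conj (h : SymmSqrt S Q R) (X : Matrix (Fin n) (Fin n) ℝ) :
    R * (Q * X * Q) * R = X := by
  rw [Matrix.mul_assoc Q, h.inv_mul_cancel, Matrix.mul_assoc, h.mul_inv, Matrix.mul_one]

lemma inv_conj_self (h : SymmSqrt S Q R) : R * S * R = 1 := by
  rw [← h.mul_self, h.inv_mul_cancel, h.mul_inv]

lemma inv_conj_symm (h : SymmSqrt S Q R) {X : Matrix (Fin n) (Fin n) ℝ} (hX : Xᵀ = X) :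
    (R * X * R)ᵀ = R * X * R := by
  simp only [Matrix.transpose_mul, h.symm_inv, hX, Matrix.mul_assoc]

/-- If `V` inverts `R M R` then `R V R` inverts `M`. -/
lemma inv_eq_of_conj (h : SymmSqrt S Q R) {M V : Matrix (Fin n) (Fin n) ℝ}
    (hV : (R * M * R) * V = 1) : M⁻¹ = R * V * R := by
  apply Matrix.inv_eq_right_inv
  calc M * (R * V * R) = Q * (R * M * R * V) * R := by
        simp only [Matrix.mul_assoc, h.mul_inv_cancel]
    _ = 1 := by rw [hV, Matrix.mul_one, h.mul_inv]

/-- A matrix is positive definite if it is a congruence transform of one near the identity. -/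
lemma posDef_of_frob_lt_one (h : SymmSqrt S Q R) {M : Matrix (Fin n) (Fin n) ℝ} (hM : Mᵀ = M)
    (hlt : frob (R * M * R - 1) < 1) : M.PosDef := by
  refine Matrix.PosDef.of_dotProduct_mulVec_pos
    (by simpa [Matrix.IsHermitian, Matrix.conjTranspose_eq_transpose_of_trivial] using hM) ?_
  intro x hx
  have hz : Q *ᵥ x ≠ 0 := by
    intro h0
    apply hx
    have := congrArg (fun v => R *ᵥ v) h0
    simpa [Matrix.mulVec_mulVec, h.inv_mul] using this
  have hpos : 0 < (Q *ᵥ x) ⬝ᵥ (Q *ᵥ x) :=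
    lt_of_le_of_ne (Finset.sum_nonneg fun i _ => mul_self_nonneg _)
      fun h0 => hz (dotProduct_self_eq_zero.mp h0.symm)
  -- With `z = Q x`, the form `xᵀ M x` equals `zᵀ (R M R) z`, which is at least `(1 - ‖R M R - 1‖)
  -- |z|²`.
  have hb := (abs_le.mp (dotProduct_mulVec_le_frob (R * M * R - 1) (Q *ᵥ x))).1
  have he : (Q *ᵥ x) ⬝ᵥ ((R * M * R - 1) *ᵥ (Q *ᵥ x)) = x ⬝ᵥ (M *ᵥ x) - (Q *ᵥ x) ⬝ᵥ (Q *ᵥ x) := by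
    rw [Matrix.sub_mulVec, Matrix.one_mulVec, dotProduct_sub]
    congr 1
    nth_rewrite 1 [← h.symm]
    rw [Matrix.mulVec_transpose, ← Matrix.dotProduct_mulVec, Matrix.mulVec_mulVec,
      Matrix.mulVec_mulVec, h.conj_inv_conj]
  rw [he] at hb
  simp only [star_trivial]
  nlinarith

end SymmSqrt

/-! ### Estimates in an eigenbasis -/

section Spectral

variable {n : ℕ} {U : Matrix (Fin n) (Fin n) ℝ} {μ : Fin n → ℝ}

lemma one_add_eq_conj_diagonal (hU : U * Uᵀ = 1) {Z : Matrix (Fin n) (Fin n) ℝ}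
    (hZ : Z - 1 = U * Matrix.diagonal μ * Uᵀ) :
    Z = U * Matrix.diagonal (fun i => 1 + μ i) * Uᵀ := by
  have h : Matrix.diagonal (fun i => 1 + μ i) = 1 + Matrix.diagonal μ := by
    rw [← Matrix.diagonal_one, Matrix.diagonal_add]
  rw [h, Matrix.mul_add, Matrix.add_mul, Matrix.mul_one, hU, ← hZ]
  abel

lemma conj_diagonal_mul_inv (hU : U ∈ Matrix.orthogonalGroup (Fin n) ℝ)
    (hμ : ∀ i, 1 + μ i ≠ 0) :
    (U * Matrix.diagonal (fun i => 1 + μ i) * Uᵀ) *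
      (U * Matrix.diagonal (fun i => (1 + μ i)⁻¹) * Uᵀ) = 1 := by
  have h1 : Uᵀ * U = 1 := (Matrix.mem_orthogonalGroup_iff' _ _).mp hU
  have h2 : U * Uᵀ = 1 := (Matrix.mem_orthogonalGroup_iff _ _).mp hU
  have h3 : Matrix.diagonal (fun i => 1 + μ i) * Matrix.diagonal (fun i => (1 + μ i)⁻¹) = 1 := by
    rw [Matrix.diagonal_mul_diagonal, ← Matrix.diagonal_one]
    congr 1
    funext i
    exact mul_inv_cancel₀ (hμ i)
  calc _ = U * (Matrix.diagonal (fun i => 1 + μ i) * ((Uᵀ * U) *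
        Matrix.diagonal (fun i => (1 + μ i)⁻¹))) * Uᵀ := by simp only [Matrix.mul_assoc]
    _ = 1 := by rw [h1, Matrix.one_mul, h3, Matrix.mul_one, h2]

variable {c : ℝ}

/-- If the spectrum of the symmetric matrix `V` is at least `c ≥ 0`, then
`tr (V X V X) ≥ c² ‖X‖²`. -/
lemma trace_conj_diagonal_ge (hU : U ∈ Matrix.orthogonalGroup (Fin n) ℝ) {w : Fin n → ℝ}
    (hc : 0 ≤ c) (hw : ∀ i, c ≤ w i) {X : Matrix (Fin n) (Fin n) ℝ} (hX : Xᵀ = X) :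
    c ^ 2 * frob X ^ 2 ≤
      ((U * Matrix.diagonal w * Uᵀ) * X * (U * Matrix.diagonal w * Uᵀ) * X).trace := by
  have h1 : Uᵀ * U = 1 := (Matrix.mem_orthogonalGroup_iff' _ _).mp hU
  have h2 : U * Uᵀ = 1 := (Matrix.mem_orthogonalGroup_iff _ _).mp hU
  set B := Uᵀ * X * U with hB
  have hBs : ∀ i j, B i j = B j i := by
    have : Bᵀ = B := by simp only [hB, Matrix.transpose_mul, Matrix.transpose_transpose, hX,
      Matrix.mul_assoc]
    intro i j
    conv_lhs => rw [← this]
    rfl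
  have hfB : frob B = frob X := by
    rw [hB, frob_mul_right h2, frob_mul_left (by simpa using h2)]
  have ht : ((U * Matrix.diagonal w * Uᵀ) * X * (U * Matrix.diagonal w * Uᵀ) * X).trace =
      (Matrix.diagonal w * B * (Matrix.diagonal w * B)).trace := by
    rw [show (U * Matrix.diagonal w * Uᵀ) * X * (U * Matrix.diagonal w * Uᵀ) * X =
      U * (Matrix.diagonal w * Uᵀ * X * (U * Matrix.diagonal w * Uᵀ) * X) by
        simp only [Matrix.mul_assoc], Matrix.trace_mul_comm]
    simp only [hB, Matrix.mul_assoc]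
  -- In the eigenbasis the trace is `∑ w_i w_j B_ij²`, so the bound is termwise.
  rw [ht, ← hfB, frob_sq, Matrix.trace, Finset.mul_sum]
  refine Finset.sum_le_sum fun i _ => ?_
  rw [Matrix.diag_apply, Matrix.mul_apply, Finset.mul_sum]
  refine Finset.sum_le_sum fun j _ => ?_
  rw [Matrix.diagonal_mul, Matrix.diagonal_mul, hBs j i]
  have : c * c ≤ w i * w j := mul_le_mul (hw i) (hw j) hc (hc.trans (hw i))
  nlinarith [mul_le_mul_of_nonneg_right this (sq_nonneg (B i j))]

/-- The change of `X` under congruence by a symmetric matrix is controlled by the entries. -/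
lemma frob_sub_conj_diagonal_le (hU : U ∈ Matrix.orthogonalGroup (Fin n) ℝ) {w : Fin n → ℝ}
    (hc : 0 ≤ c) (hw : ∀ i j, |1 - w i * w j| ≤ c) (X : Matrix (Fin n) (Fin n) ℝ) :
    frob (X - (U * Matrix.diagonal w * Uᵀ) * X * (U * Matrix.diagonal w * Uᵀ)) ≤ c * frob X := by
  have h1 : Uᵀ * U = 1 := (Matrix.mem_orthogonalGroup_iff' _ _).mp hU
  have h2 : U * Uᵀ = 1 := (Matrix.mem_orthogonalGroup_iff _ _).mp hU
  set B := Uᵀ * X * U with hB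
  have hX : X = U * B * Uᵀ := by
    rw [hB, show U * (Uᵀ * X * U) * Uᵀ = (U * Uᵀ) * X * (U * Uᵀ) by
      simp only [Matrix.mul_assoc], h2, Matrix.one_mul, Matrix.mul_one]
  have hconj : ∀ Y : Matrix (Fin n) (Fin n) ℝ, frob (U * Y * Uᵀ) = frob Y := fun Y => by
    rw [frob_mul_right (by simpa using h1), frob_mul_left h1]
  have he : X - (U * Matrix.diagonal w * Uᵀ) * X * (U * Matrix.diagonal w * Uᵀ) =
      U * (B - Matrix.diagonal w * B * Matrix.diagonal w) * Uᵀ := by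
    rw [Matrix.mul_sub, Matrix.sub_mul, ← hX, hB]
    simp only [Matrix.mul_assoc]
  rw [he, hconj]
  conv_rhs => rw [hX, hconj]
  refine frob_le_of_abs_le hc fun i j => ?_
  rw [Matrix.sub_apply, Matrix.mul_diagonal, Matrix.diagonal_mul,
    show B i j - w i * B i j * w j = (1 - w i * w j) * B i j by ring, abs_mul]
  exact mul_le_mul_of_nonneg_right (hw i j) (abs_nonneg _)

/-- The extreme case is `a = b = -1/100`, with value `1/0.9801 - 1 < 0.0204`. -/
lemma abs_one_sub_inv_mul_inv_le {a b : ℝ} (ha : |a| ≤ 1 / 100) (hb : |b| ≤ 1 / 100) :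
    |1 - (1 + a)⁻¹ * (1 + b)⁻¹| ≤ 21 / 1000 := by
  rw [abs_le] at ha hb
  have ha0 : 0 < 1 + a := by linarith
  have hb0 : 0 < 1 + b := by linarith
  have hp : 0 < (1 + a) * (1 + b) := mul_pos ha0 hb0
  have h : 1 - (1 + a)⁻¹ * (1 + b)⁻¹ = (a + b + a * b) / ((1 + a) * (1 + b)) := by
    field_simp
    ring
  rw [h, abs_div, abs_of_pos hp, div_le_iff₀ hp, abs_le]
  constructor <;> nlinarith

end Spectral

/-! ### Perturbation of the inverse -/

section Inverse

variable {n : ℕ} {E G : Matrix (Fin n) (Fin n) ℝ}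

/-- This isolates the first-order term of `1 - (1 + E)⁻¹`. It yields the norm bound below, and the
cancellation in the Newton step. -/
lemma one_sub_inv_eq (hG : (1 + E) * G = 1) : 1 - G = E - E * (1 - G) := by
  have : G + E * G = 1 := by rw [← hG, Matrix.add_mul, Matrix.one_mul]
  rw [Matrix.mul_sub, Matrix.mul_one, ← this]
  abel

/-- `(1 + E)⁻¹ - 1` is of the size of `E`. -/
lemma frob_inv_sub_one_le {e : ℝ} (hG : (1 + E) * G = 1) (he : frob E ≤ e) (he1 : e < 1) :
    frob (1 - G) ≤ frob E / (1 - e) := by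
  have hle : frob (1 - G) ≤ frob E + frob E * frob (1 - G) := by
    conv_lhs => rw [one_sub_inv_eq hG, sub_eq_add_neg]
    refine (frob_add_le _ _).trans ?_
    rw [frob_neg]
    gcongr
    exact frob_mul_le _ _
  rw [le_div_iff₀ (by linarith)]
  nlinarith [frob_nonneg (1 - G), frob_nonneg E]

end Inverse

/-! ### Hessian, gradient and Newton decrement -/

namespace SDPData

variable {n m : ℕ} (P : SDPData n m)

/-- The linear combination of the constraint matrices with coefficients `v`. -/
def comb (v : Fin m → ℝ) : Matrix (Fin n) (Fin n) ℝ := ∑ i, v i • P.A i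

lemma comb_symm (v : Fin m → ℝ) : (P.comb v)ᵀ = P.comb v := by
  rw [comb, Matrix.transpose_sum]
  exact Finset.sum_congr rfl fun i _ => by rw [Matrix.transpose_smul, (P.A_symm i).eq]

lemma slack_symm (y : Fin m → ℝ) : (P.slack y)ᵀ = P.slack y := by
  change (P.comb y - P.C)ᵀ = P.comb y - P.C
  rw [Matrix.transpose_sub, P.comb_symm, P.C_symm.eq]

lemma slack_sub (y x : Fin m → ℝ) : P.slack (y - x) = P.slack y - P.comb x := by
  simp only [slack, comb, Pi.sub_apply, sub_smul, Finset.sum_sub_distrib]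
  abel

variable {P} in
lemma comb_eq_zero (hP : P.NoRedundantConstraints) {v : Fin m → ℝ} (h : P.comb v = 0) : v = 0 :=
  funext (Fintype.linearIndependent_iff.mp hP v h)

lemma trace_mul_comb (M : Matrix (Fin n) (Fin n) ℝ) (v : Fin m → ℝ) :
    (M * P.comb v).trace = ∑ i, v i * (M * P.A i).trace := by
  simp [comb, Matrix.mul_sum, Matrix.trace_sum, Matrix.trace_smul]

lemma gradient_dotProduct (η : ℝ) (y v : Fin m → ℝ) :
    P.gradient η y ⬝ᵥ v = η * (P.b ⬝ᵥ v) - ((P.slack y)⁻¹ * P.comb v).trace := by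
  rw [trace_mul_comb]
  simp only [dotProduct, gradient, Finset.mul_sum, ← Finset.sum_sub_distrib]
  exact Finset.sum_congr rfl fun i _ => by ring

lemma dotProduct_hessian_mulVec (M : Matrix (Fin n) (Fin n) ℝ) (u v : Fin m → ℝ) :
    u ⬝ᵥ (P.hessian M *ᵥ v) = (M⁻¹ * P.comb u * M⁻¹ * P.comb v).trace := by
  rw [trace_mul_comb]
  simp only [dotProduct, Matrix.mulVec, hessian, Matrix.of_apply, Finset.mul_sum]
  rw [Finset.sum_comm]
  refine Finset.sum_congr rfl fun k _ => ?_
  rw [show M⁻¹ * P.comb u * M⁻¹ * P.A k = M⁻¹ * (P.comb u * (M⁻¹ * P.A k)) by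
    simp only [Matrix.mul_assoc], Matrix.trace_mul_comm,
    show P.comb u * (M⁻¹ * P.A k) * M⁻¹ = P.comb u * (M⁻¹ * P.A k * M⁻¹) by
    simp only [Matrix.mul_assoc], Matrix.trace_mul_comm, trace_mul_comb, Finset.mul_sum]
  refine Finset.sum_congr rfl fun j _ => ?_
  rw [show M⁻¹ * P.A j * M⁻¹ * P.A k = M⁻¹ * P.A j * (M⁻¹ * P.A k) by
    simp only [Matrix.mul_assoc], Matrix.trace_mul_comm,
    show M⁻¹ * P.A k * (M⁻¹ * P.A j) = M⁻¹ * P.A k * M⁻¹ * P.A j by simp only [Matrix.mul_assoc]]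
  ring

/-- The Hessian is invertible if its quadratic form vanishes only on combinations that vanish. -/
lemma hessian_mulVec_inv (hP : P.NoRedundantConstraints) {M : Matrix (Fin n) (Fin n) ℝ}
    (h : ∀ v, (M⁻¹ * P.comb v * M⁻¹ * P.comb v).trace = 0 → P.comb v = 0) (g : Fin m → ℝ) :
    P.hessian M *ᵥ ((P.hessian M)⁻¹ *ᵥ g) = g := by
  have hu : IsUnit (P.hessian M) := by
    rw [← Matrix.mulVec_injective_iff_isUnit]
    intro u v huv
    have h0 : P.hessian M *ᵥ (u - v) = 0 := by
      rw [Matrix.mulVec_sub, sub_eq_zero]; exact huv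
    have := P.dotProduct_hessian_mulVec M (u - v) (u - v)
    rw [h0, dotProduct_zero] at this
    exact sub_eq_zero.mp (comb_eq_zero hP (h _ this.symm))
  rw [Matrix.mulVec_mulVec, Matrix.mul_nonsing_inv _ ((Matrix.isUnit_iff_isUnit_det _).mp hu),
    Matrix.one_mulVec]

variable {P} {S Q R : Matrix (Fin n) (Fin n) ℝ}

lemma trace_inv_comb (h : SymmSqrt S Q R) (X Y : Matrix (Fin n) (Fin n) ℝ) :
    (S⁻¹ * X * S⁻¹ * Y).trace = (R * X * R * (R * Y * R)).trace := by
  rw [h.inv_eq, show R * R * X * (R * R) * Y = R * (R * X * R * (R * Y)) by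
    simp only [Matrix.mul_assoc], Matrix.trace_mul_comm]
  simp only [Matrix.mul_assoc]

lemma comb_eq_zero_of_frob (h : SymmSqrt S Q R) {v : Fin m → ℝ}
    (h0 : frob (R * P.comb v * R) = 0) : P.comb v = 0 := by
  rw [← h.conj_inv_conj (P.comb v), frob_eq_zero h0, Matrix.mul_zero, Matrix.zero_mul]

/-- The Newton decrement is the dual norm of the gradient. -/
lemma nearCentralPath_iff (hP : P.NoRedundantConstraints) {εN η : ℝ} (hε : 0 ≤ εN)
    {y : Fin m → ℝ} (h : SymmSqrt (P.slack y) Q R) :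
    P.NearCentralPath εN η y ↔ (P.slack y).PosDef ∧
      ∀ v, |P.gradient η y ⬝ᵥ v| ≤ εN * frob (R * P.comb v * R) := by
  have hquad : ∀ v, ((P.slack y)⁻¹ * P.comb v * (P.slack y)⁻¹ * P.comb v).trace =
      frob (R * P.comb v * R) ^ 2 := fun v => by
    rw [trace_inv_comb h, frob_sq_eq_trace, h.inv_conj_symm (P.comb_symm v)]
  have hinv := P.hessian_mulVec_inv hP (M := P.slack y) (fun v hv =>
    comb_eq_zero_of_frob h (by rw [hquad] at hv; exact pow_eq_zero_iff two_ne_zero |>.mp hv))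
    (P.gradient η y)
  set g := P.gradient η y
  set x := (P.hessian (P.slack y))⁻¹ *ᵥ g with hx
  have hgx : ∀ v, v ⬝ᵥ g = (R * P.comb v * R * (R * P.comb x * R)).trace := fun v => by
    conv_lhs => rw [← hinv]
    rw [dotProduct_hessian_mulVec, trace_inv_comb h]
  have hxx : g ⬝ᵥ x = frob (R * P.comb x * R) ^ 2 := by
    rw [dotProduct_comm, hgx, frob_sq_eq_trace, h.inv_conj_symm (P.comb_symm x)]
  have hf := frob_nonneg (R * P.comb x * R)
  refine and_congr_right fun _ => ⟨fun hle v => ?_, fun hle => ?_⟩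
  · rw [← hx, hxx, sq_le_sq₀ hf hε] at hle
    rw [dotProduct_comm, hgx, mul_comm εN]
    exact (abs_trace_mul_le _ _).trans (mul_le_mul_of_nonneg_left hle (frob_nonneg _))
  -- The Newton direction `x` attains the dual norm, so testing against it suffices.
  · have := hle x
    rw [hxx, abs_of_nonneg (sq_nonneg _)] at this
    rw [← hx, hxx, sq_le_sq₀ hf hε]
    by_contra! hlt
    nlinarith

end SDPData

/-! ### The approximate Newton step -/

section Newton

variable {n : ℕ}

lemma frob_mul_one_add_le (M E : Matrix (Fin n) (Fin n) ℝ) :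
    frob (M * (1 + E)) ≤ frob M * (1 + frob E) := by
  rw [Matrix.mul_add, Matrix.mul_one, mul_add, mul_one]
  exact (frob_add_le _ _).trans (add_le_add_right (frob_mul_le _ _) _)

/-- The local norm at `S'` is comparable to that at `S`. -/
lemma SymmSqrt.frob_conj_le {S Q R S' Q' R' : Matrix (Fin n) (Fin n) ℝ} (h : SymmSqrt S Q R)
    (h' : SymmSqrt S' Q' R') (M : Matrix (Fin n) (Fin n) ℝ) :
    frob (Q' * (R * M * R) * Q') ≤ frob M * (1 + frob (R * S' * R - 1)) := by
  set E := R * S' * R - 1 with hE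
  have hRS : R * S' * R = 1 + E := by rw [hE]; abel
  have hb : 0 ≤ frob M * (1 + frob E) :=
    mul_nonneg (frob_nonneg _) (by linarith [frob_nonneg E])
  rw [← sq_le_sq₀ (frob_nonneg _) hb, frob_sq_eq_trace]
  have ht : (Q' * (R * M * R) * Q')ᵀ * (Q' * (R * M * R) * Q') =
      Q' * (R * (Mᵀ * (R * S' * R) * (M * (R * Q')))) := by
    simp only [Matrix.transpose_mul, h.symm_inv, h'.symm, ← h'.mul_self, Matrix.mul_assoc]
  have ht' : Mᵀ * (1 + E) * (M * (R * Q')) * Q' * R = Mᵀ * (1 + E) * (M * (R * S' * R)) := by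
    simp only [← h'.mul_self, Matrix.mul_assoc]
  -- By cyclicity the squared norm is `tr (Mᵀ (1 + E) M (1 + E))`, to which Cauchy–Schwarz applies.
  rw [ht, Matrix.trace_mul_comm, Matrix.mul_assoc, Matrix.trace_mul_comm, hRS, ht', hRS, sq]
  refine (le_abs_self _).trans ((abs_trace_mul_le _ _).trans ?_)
  have h1 := frob_mul_one_add_le Mᵀ E
  rw [frob_transpose] at h1
  exact mul_le_mul h1 (frob_mul_one_add_le M E) (frob_nonneg _) hb

end Newton

namespace SDPData

variable {n m : ℕ} {P : SDPData n m}

/-- The quantitative effect of an approximate Newton step: the slack matrix moves little in its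
local norm, and the Newton decrement is at most `εN` again. -/
lemma newton_step (hP : P.NoRedundantConstraints) {εN η : ℝ} (hε : 0 < εN)
    (hε1 : εN ≤ 1 / 10) {y : Fin m → ℝ} {Q R St U : Matrix (Fin n) (Fin n) ℝ} {μ : Fin n → ℝ}
    (h : SymmSqrt (P.slack y) Q R) (hU : U ∈ Matrix.orthogonalGroup (Fin n) ℝ)
    (hZ : R * St * R - 1 = U * Matrix.diagonal μ * Uᵀ) (hμ : ∀ i, |μ i| ≤ 1 / 100)
    (hg : ∀ v, |P.gradient η y ⬝ᵥ v| ≤ 106 / 100 * εN * frob (R * P.comb v * R))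
    {y' : Fin m → ℝ} (hy' : y' = y - (P.hessian St)⁻¹ *ᵥ P.gradient η y) :
    P.NearCentralPath εN η y' ∧ frob (R * P.slack y' * R - 1) ≤ 11 / 100 := by
  have hU2 : U * Uᵀ = 1 := (Matrix.mem_orthogonalGroup_iff _ _).mp hU
  have hμ' := fun i => abs_le.mp (hμ i)
  -- `V` is the inverse of `R S̃ R`, so in local coordinates the approximate Hessian form is `tr (V
  -- X V Y)`. It would be `tr (X Y)` for the exact Hessian.
  set V := U * Matrix.diagonal (fun i => (1 + μ i)⁻¹) * Uᵀ with hV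
  have hStinv : St⁻¹ = R * V * R := by
    apply h.inv_eq_of_conj
    rw [one_add_eq_conj_diagonal hU2 hZ]
    exact conj_diagonal_mul_inv hU fun i => by linarith [(hμ' i).1]
  have hquad : ∀ u v, (St⁻¹ * P.comb u * St⁻¹ * P.comb v).trace =
      (V * (R * P.comb u * R) * V * (R * P.comb v * R)).trace := fun u v => by
    rw [hStinv, show R * V * R * P.comb u * (R * V * R) * P.comb v =
      R * (V * (R * (P.comb u * (R * (V * (R * P.comb v)))))) by simp only [Matrix.mul_assoc],
      Matrix.trace_mul_comm]
    simp only [Matrix.mul_assoc]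
  have hge : ∀ v, (100 / 101) ^ 2 * frob (R * P.comb v * R) ^ 2 ≤
      (St⁻¹ * P.comb v * St⁻¹ * P.comb v).trace := fun v => by
    rw [hquad]
    refine trace_conj_diagonal_ge hU (by norm_num) (fun i => ?_) (h.inv_conj_symm (P.comb_symm v))
    rw [le_inv_comm₀ (by norm_num) (by linarith [(hμ' i).1])]
    linarith [(hμ' i).2]
  have hinv := P.hessian_mulVec_inv hP (M := St) (fun v hv => comb_eq_zero_of_frob h (by
    have := hge v
    rw [hv] at this
    nlinarith [frob_nonneg (R * P.comb v * R)])) (P.gradient η y)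
  set x := (P.hessian St)⁻¹ *ᵥ P.gradient η y with hx
  set X := R * P.comb x * R with hX
  have hgv : ∀ v, P.gradient η y ⬝ᵥ v = (V * X * V * (R * P.comb v * R)).trace := fun v => by
    conv_lhs => rw [← hinv]
    rw [dotProduct_comm, dotProduct_hessian_mulVec, hquad, Matrix.mul_assoc,
      Matrix.trace_mul_comm, ← hX, ← Matrix.mul_assoc]
  -- The constant is `1.06 · 1.01² < 1.082`: the gradient bound times the distortion of the
  -- approximate Hessian.
  have hXle : frob X ≤ 1082 / 1000 * εN := by
    have h1 := hge x
    have h2 := hg x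
    rw [hquad, ← hX, ← hgv] at h1
    rw [← hX] at h2
    have h3 := h1.trans ((le_abs_self _).trans h2)
    by_contra! hlt
    nlinarith [frob_nonneg X]
  have hXle' : frob X ≤ 11 / 100 := by linarith
  have hslack : R * P.slack y' * R = 1 + -X := by
    rw [hy', slack_sub, Matrix.mul_sub, Matrix.sub_mul, h.inv_conj_self, ← hX, sub_eq_add_neg]
  have hmove : R * P.slack y' * R - 1 = -X := by rw [hslack]; abel
  have hpd : (P.slack y').PosDef := by
    refine h.posDef_of_frob_lt_one (P.slack_symm y') ?_
    rw [hmove, frob_neg]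
    linarith
  have h' := SymmSqrt.of_posDef hpd
  refine ⟨(nearCentralPath_iff hP hε.le h').mpr ⟨hpd, fun v => ?_⟩, by rwa [hmove, frob_neg]⟩
  set Q' := CFC.sqrt (P.slack y')
  set R' := Q'⁻¹
  set G := Q * (P.slack y')⁻¹ * Q with hG
  have hG1 : (1 + -X) * G = 1 := by
    rw [← hslack, hG, show R * P.slack y' * R * (Q * (P.slack y')⁻¹ * Q) =
      R * P.slack y' * (R * (Q * ((P.slack y')⁻¹ * Q))) by simp only [Matrix.mul_assoc],
      h.inv_mul_cancel, Matrix.mul_assoc, ← Matrix.mul_assoc (P.slack y'),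
      Matrix.mul_nonsing_inv _ ((Matrix.isUnit_iff_isUnit_det _).mp hpd.isUnit), Matrix.one_mul,
      h.inv_mul]
  have hdG : frob (1 - G) ≤ frob X / (1 - 11 / 100) := by
    have := frob_inv_sub_one_le hG1 (by rwa [frob_neg]) (by norm_num : (11 : ℝ) / 100 < 1)
    rwa [frob_neg] at this
  -- `M` represents the gradient at `y'` in the local coordinates of `y`: `V X V` is the old
  -- gradient, and `1 - G` is the change of the inverse slack matrix.
  set M := V * X * V + (1 - G) with hM
  have hgM : P.gradient η y' ⬝ᵥ v = (M * (R * P.comb v * R)).trace := by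
    have e1 := hgv v
    rw [gradient_dotProduct] at e1 ⊢
    have e2 : ((P.slack y)⁻¹ * P.comb v).trace = (R * P.comb v * R).trace := by
      rw [h.inv_eq, Matrix.mul_assoc, Matrix.trace_mul_comm]
    have e3 : ((P.slack y')⁻¹ * P.comb v).trace = (G * (R * P.comb v * R)).trace := by
      rw [← h.inv_conj_conj (P.slack y')⁻¹, ← hG, Matrix.mul_assoc, Matrix.mul_assoc,
        Matrix.trace_mul_comm]
      simp only [Matrix.mul_assoc]
    rw [hM, Matrix.add_mul, Matrix.sub_mul, Matrix.one_mul, Matrix.trace_add, Matrix.trace_sub,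
      ← e1, e2, e3]
    ring
  have hMle : frob M ≤ 15 / 100 * frob X := by
    -- The leading part `-X` of `1 - G` cancels `V X V` up to the Hessian error. What remains is at
    -- most `0.021 ‖X‖ + ‖X‖² / 0.89`, hence at most `0.15 ‖X‖`.
    have e : M = -(X - V * X * V) + X * (1 - G) := by
      have hd : 1 - G = -X + X * (1 - G) := by
        conv_lhs => rw [one_sub_inv_eq hG1, Matrix.neg_mul, sub_neg_eq_add]
      calc M = V * X * V + (-X + X * (1 - G)) := congrArg (V * X * V + ·) hd
        _ = _ := by abel
    have h1 := frob_sub_conj_diagonal_le hU (by norm_num : (0 : ℝ) ≤ 21 / 1000)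
      (fun i j => abs_one_sub_inv_mul_inv_le (hμ i) (hμ j)) X
    rw [← hV] at h1
    have h2 := frob_mul_le X (1 - G)
    have h3 := frob_add_le (-(X - V * X * V)) (X * (1 - G))
    rw [← e, frob_neg] at h3
    have h4 := mul_le_mul_of_nonneg_left hdG (frob_nonneg X)
    have h5 : frob X * (frob X / (1 - 11 / 100)) ≤ 1236 / 10000 * frob X := by
      rw [mul_div_assoc', div_le_iff₀ (by norm_num)]
      nlinarith [frob_nonneg X]
    linarith [frob_nonneg X]
  have hB : (M * (R * P.comb v * R)).trace =
      ((Q' * (R * M * R) * Q') * (R' * P.comb v * R')).trace := by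
    conv_lhs => rw [← h'.conj_inv_conj (P.comb v)]
    rw [show M * (R * (Q' * (R' * P.comb v * R') * Q') * R) =
      M * (R * (Q' * (R' * P.comb v * R'))) * (Q' * R) by simp only [Matrix.mul_assoc],
      Matrix.trace_mul_comm]
    simp only [Matrix.mul_assoc]
  rw [hgM, hB]
  refine (abs_trace_mul_le _ _).trans (mul_le_mul_of_nonneg_right ?_ (frob_nonneg _))
  -- Passing to the local norm at `y'` costs a factor `1 + ‖X‖ ≤ 1.11`, and `0.15 · 1.082 · 1.11 <
  -- 1`.
  have hN := h.frob_conj_le h' M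
  rw [hmove, frob_neg] at hN
  nlinarith [frob_nonneg M, frob_nonneg X]

/-- Increasing `η` by the factor `1 + εN / (20 √n)` perturbs the dual norm of the gradient
little. -/
lemma gradient_increase {εN η : ℝ} (hε : 0 < εN) (hε1 : εN ≤ 1 / 10) (hn : 1 ≤ n)
    {y : Fin m → ℝ} {Q R : Matrix (Fin n) (Fin n) ℝ} (h : SymmSqrt (P.slack y) Q R)
    (hg : ∀ v, |P.gradient η y ⬝ᵥ v| ≤ εN * frob (R * P.comb v * R)) (v : Fin m → ℝ) :
    |P.gradient (η * (1 + εN / (20 * √(n : ℝ)))) y ⬝ᵥ v| ≤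
      106 / 100 * εN * frob (R * P.comb v * R) := by
  have hn1 : 1 ≤ √(n : ℝ) := Real.one_le_sqrt.mpr (by exact_mod_cast hn)
  set κ := εN / (20 * √(n : ℝ)) with hκ
  have hκ0 : 0 ≤ κ := by positivity
  have hκ1 : κ * √(n : ℝ) = εN / 20 := by
    rw [hκ]
    field_simp
  have hκ2 : κ ≤ 1 / 200 := by nlinarith
  have htr : |(R * P.comb v * R).trace| ≤ √n * frob (R * P.comb v * R) := by
    have := abs_trace_mul_le 1 (R * P.comb v * R)
    rwa [Matrix.one_mul, frob_one] at this
  -- The gradient scales by `1 + κ ≤ 1.005`, and the extra trace costs `κ √n = εN / 20`. The total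
  -- factor 1.055 is below 1.06.
  have e : P.gradient (η * (1 + κ)) y ⬝ᵥ v =
      (1 + κ) * (P.gradient η y ⬝ᵥ v) + κ * (R * P.comb v * R).trace := by
    rw [gradient_dotProduct, gradient_dotProduct, h.inv_eq, Matrix.mul_assoc,
      Matrix.trace_mul_comm]
    ring
  rw [e]
  refine (abs_add_le _ _).trans ?_
  rw [abs_mul, abs_mul, abs_of_nonneg hκ0, abs_of_nonneg (by linarith : 0 ≤ 1 + κ)]
  have h1 := mul_le_mul_of_nonneg_left (hg v) (by linarith : 0 ≤ 1 + κ)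
  have h2 := mul_le_mul_of_nonneg_left htr hκ0
  rw [← mul_assoc, hκ1] at h2
  have h3 : 0 ≤ (1 / 200 - κ) * (εN * frob (R * P.comb v * R)) :=
    mul_nonneg (by linarith) (mul_nonneg hε.le (frob_nonneg _))
  have h4 : 0 ≤ εN * frob (R * P.comb v * R) := mul_nonneg hε.le (frob_nonneg _)
  nlinarith

end SDPData

/-! ### The potential function and its Lipschitz bound -/

section Potential

variable {n : ℕ}

/-- The weights `1, 1/√2, 1/√3, …` of the potential function. -/
def weight (i : Fin n) : ℝ := 1 / √((i : ℝ) + 1)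

lemma weight_pos (i : Fin n) : 0 < weight i := by
  unfold weight
  positivity

lemma weight_antitone : Antitone (weight : Fin n → ℝ) := fun i j hij => by
  unfold weight
  have : (i : ℝ) ≤ j := by exact_mod_cast hij
  gcongr

/-- The weighted sum of the decreasingly sorted absolute values of `lam`. -/
def potential (lam : Fin n → ℝ) : ℝ :=
  Finset.univ.sup' ⟨1, Finset.mem_univ _⟩
    fun σ : Equiv.Perm (Fin n) => ∑ i, weight i * |lam (σ i)|

lemma le_potential (lam : Fin n → ℝ) (σ : Equiv.Perm (Fin n)) :
    ∑ i, weight i * |lam (σ i)| ≤ potential lam :=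
  Finset.le_sup' (fun σ : Equiv.Perm (Fin n) => ∑ i, weight i * |lam (σ i)|) (Finset.mem_univ σ)

lemma potential_le {lam : Fin n → ℝ} {c : ℝ} (h : ∀ σ : Equiv.Perm (Fin n),
    ∑ i, weight i * |lam (σ i)| ≤ c) : potential lam ≤ c :=
  Finset.sup'_le _ _ fun σ _ => h σ

lemma potential_nonneg (lam : Fin n → ℝ) : 0 ≤ potential lam :=
  (Finset.sum_nonneg fun i _ => mul_nonneg (weight_pos i).le (abs_nonneg _)).trans
    (le_potential lam 1)

lemma potential_zero : potential (0 : Fin n → ℝ) = 0 :=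
  le_antisymm (potential_le fun σ => by simp) (potential_nonneg _)

/-- Averaging by a doubly stochastic matrix does not exceed the potential. -/
lemma sum_weight_doublyStochastic_le {D : Matrix (Fin n) (Fin n) ℝ}
    (hD : D ∈ doublyStochastic ℝ (Fin n)) (μ : Fin n → ℝ) :
    ∑ i, weight i * ∑ j, D i j * |μ j| ≤ potential μ := by
  -- Birkhoff: a doubly stochastic matrix is a convex combination of permutation matrices, and the
  -- potential is the maximum over permutations.
  obtain ⟨w, hw0, hw1, rfl⟩ := exists_eq_sum_perm_of_mem_doublyStochastic hD
  have h : ∀ i, ∑ j, (∑ σ : Equiv.Perm (Fin n), w σ • σ.permMatrix ℝ) i j * |μ j| =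
      ∑ σ : Equiv.Perm (Fin n), w σ * |μ (σ i)| := fun i => by
    simp only [Matrix.sum_apply, Finset.sum_mul]
    rw [Finset.sum_comm]
    refine Finset.sum_congr rfl fun σ _ => ?_
    simp [Matrix.smul_apply, Equiv.Perm.permMatrix, PEquiv.toMatrix_apply, Equiv.toPEquiv_apply]
  calc ∑ i, weight i * ∑ j, (∑ σ : Equiv.Perm (Fin n), w σ • σ.permMatrix ℝ) i j * |μ j|
      = ∑ σ : Equiv.Perm (Fin n), w σ * ∑ i, weight i * |μ (σ i)| := by
        simp only [h, Finset.mul_sum]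
        rw [Finset.sum_comm]
        exact Finset.sum_congr rfl fun σ _ => Finset.sum_congr rfl fun i _ => by ring
    _ ≤ ∑ σ : Equiv.Perm (Fin n), w σ * potential μ :=
        Finset.sum_le_sum fun σ _ => mul_le_mul_of_nonneg_left (le_potential μ σ) (hw0 σ)
    _ = potential μ := by rw [← Finset.sum_mul, hw1, one_mul]

lemma orthogonal_sq_mem_doublyStochastic {W : Matrix (Fin n) (Fin n) ℝ}
    (hW : W ∈ Matrix.orthogonalGroup (Fin n) ℝ) (σ : Equiv.Perm (Fin n)) :
    (Matrix.of fun i j => W j (σ i) ^ 2) ∈ doublyStochastic ℝ (Fin n) := by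
  have h1 : Wᵀ * W = 1 := (Matrix.mem_orthogonalGroup_iff' _ _).mp hW
  have h2 : W * Wᵀ = 1 := (Matrix.mem_orthogonalGroup_iff _ _).mp hW
  rw [mem_doublyStochastic_iff_sum]
  refine ⟨fun i j => sq_nonneg _, fun i => ?_, fun j => ?_⟩
  · have := congrFun (congrFun h1 (σ i)) (σ i)
    rw [Matrix.mul_apply, Matrix.one_apply_eq] at this
    simpa [sq] using this
  · have := congrFun (congrFun h2 j) j
    rw [Matrix.mul_apply, Matrix.one_apply_eq] at this
    simp only [Matrix.of_apply]
    rw [Equiv.sum_comp σ fun k => W j k ^ 2]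
    simpa [sq] using this

/-- The potential is Lipschitz in the Frobenius norm. -/
lemma potential_le_add_frob {W : Matrix (Fin n) (Fin n) ℝ}
    (hW : W ∈ Matrix.orthogonalGroup (Fin n) ℝ) (lam μ : Fin n → ℝ) :
    potential lam ≤ potential μ + √(∑ i : Fin n, weight i ^ 2) *
      frob (W * Matrix.diagonal lam * Wᵀ - Matrix.diagonal μ) := by
  have h1 : Wᵀ * W = 1 := (Matrix.mem_orthogonalGroup_iff' _ _).mp hW
  have h2 : W * Wᵀ = 1 := (Matrix.mem_orthogonalGroup_iff _ _).mp hW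
  set F := W * Matrix.diagonal lam * Wᵀ - Matrix.diagonal μ with hF
  set F' := Wᵀ * F * W with hF'
  have hfF : frob F' = frob F := by
    rw [hF', frob_mul_right h2, frob_mul_left (by simpa using h2)]
  -- Reading off the diagonal of the rotated identity: each `lam k` is an average of the `μ j` with
  -- weights `W j k ^ 2`, up to a diagonal entry of the error.
  have hlam : ∀ k, lam k = ∑ j, W j k ^ 2 * μ j + F' k k := fun k => by
    have e : Matrix.diagonal lam = Wᵀ * Matrix.diagonal μ * W + F' := by
      rw [hF', hF, Matrix.mul_sub, Matrix.sub_mul,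
        show Wᵀ * (W * Matrix.diagonal lam * Wᵀ) * W =
          (Wᵀ * W) * Matrix.diagonal lam * (Wᵀ * W) by simp only [Matrix.mul_assoc],
        h1, Matrix.one_mul, Matrix.mul_one]
      abel
    have := congrFun (congrFun e k) k
    rw [Matrix.diagonal_apply_eq, Matrix.add_apply, Matrix.mul_apply] at this
    rw [this]
    congr 1
    refine Finset.sum_congr rfl fun j _ => ?_
    rw [Matrix.mul_diagonal, Matrix.transpose_apply]
    ring
  refine potential_le fun σ => ?_
  have hb : ∀ i, weight i * |lam (σ i)| ≤
      weight i * ∑ j, (Matrix.of fun i j => W j (σ i) ^ 2 : Matrix (Fin n) (Fin n) ℝ) i j * |μ j| +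
        weight i * |F' (σ i) (σ i)| := fun i => by
    rw [← mul_add]
    refine mul_le_mul_of_nonneg_left ?_ (weight_pos i).le
    rw [hlam (σ i)]
    refine (abs_add_le _ _).trans (add_le_add_left ((Finset.abs_sum_le_sum_abs _ _).trans ?_) _)
    refine Finset.sum_le_sum fun j _ => ?_
    rw [abs_mul, abs_of_nonneg (sq_nonneg _), Matrix.of_apply]
  refine (Finset.sum_le_sum fun i _ => hb i).trans ?_
  rw [Finset.sum_add_distrib]
  refine add_le_add (sum_weight_doublyStochastic_le (orthogonal_sq_mem_doublyStochastic hW σ) μ) ?_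
  -- Cauchy–Schwarz against the weights; the diagonal of `F'` has Euclidean norm at most `frob F'`.
  refine (Real.sum_mul_le_sqrt_mul_sqrt _ _ _).trans ?_
  refine mul_le_mul_of_nonneg_left ?_ (Real.sqrt_nonneg _)
  rw [← hfF, frob]
  refine Real.sqrt_le_sqrt ?_
  simp only [sq_abs]
  rw [Equiv.sum_comp σ fun k => F' k k ^ 2]
  exact Finset.sum_le_sum fun i _ => Finset.single_le_sum (f := fun j => F' i j ^ 2)
    (fun _ _ => sq_nonneg _) (Finset.mem_univ i)

end Potential

/-! ### Growth of the potential when the slack matrix moves -/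

section Movement

variable {n : ℕ}

/-- The effect on the potential of moving the slack matrix from `S` to `S'`. -/
lemma potential_le_of_move {S Q R S' Q' R' St U U' : Matrix (Fin n) (Fin n) ℝ}
    {μ lam : Fin n → ℝ} (h : SymmSqrt S Q R) (h' : SymmSqrt S' Q' R')
    (hS' : frob (R * S' * R - 1) ≤ 11 / 100)
    (hU : U ∈ Matrix.orthogonalGroup (Fin n) ℝ) (hU' : U' ∈ Matrix.orthogonalGroup (Fin n) ℝ)
    (hZ : R * St * R - 1 = U * Matrix.diagonal μ * Uᵀ) (hμ : ∀ i, |μ i| ≤ 1 / 100)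
    (hZ' : R' * St * R' - 1 = U' * Matrix.diagonal lam * U'ᵀ) :
    potential lam ≤ potential μ + √(∑ i : Fin n, weight i ^ 2) := by
  have hU1 : Uᵀ * U = 1 := (Matrix.mem_orthogonalGroup_iff' _ _).mp hU
  have hU2 : U * Uᵀ = 1 := (Matrix.mem_orthogonalGroup_iff _ _).mp hU
  have hU1' : U'ᵀ * U' = 1 := (Matrix.mem_orthogonalGroup_iff' _ _).mp hU'
  have hU2' : U' * U'ᵀ = 1 := (Matrix.mem_orthogonalGroup_iff _ _).mp hU'
  have hμ' := fun i => abs_le.mp (hμ i)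
  have hμ0 : ∀ i, 0 < 1 + μ i := fun i => by linarith [(hμ' i).1]
  set d : Fin n → ℝ := fun i => √(1 + μ i) with hd
  have hd0 : ∀ i, 0 < d i := fun i => Real.sqrt_pos.mpr (hμ0 i)
  have hdd : Matrix.diagonal d * Matrix.diagonal d = Matrix.diagonal fun i => 1 + μ i := by
    rw [Matrix.diagonal_mul_diagonal]
    congr 1
    funext i
    exact Real.mul_self_sqrt (hμ0 i).le
  -- `T` is chosen so that `Tᵀ T` is the new spectrum `diag(1 + lam)`, while `T Tᵀ` is a small
  -- perturbation of the old spectrum `diag(1 + μ)`.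
  set T := Matrix.diagonal d * Uᵀ * Q * R' * U' with hT
  have hTt : Tᵀ = U'ᵀ * R' * Q * U * Matrix.diagonal d := by
    simp only [hT, Matrix.transpose_mul, Matrix.transpose_transpose, Matrix.diagonal_transpose,
      h.symm, h'.symm_inv, Matrix.mul_assoc]
  have hTT : Tᵀ * T = Matrix.diagonal fun i => 1 + lam i := by
    calc Tᵀ * T = U'ᵀ * (R' * (Q * (U * (Matrix.diagonal d * Matrix.diagonal d) * Uᵀ) * Q) * R') *
          U' := by
          rw [hTt, hT]
          simp only [Matrix.mul_assoc]
      _ = U'ᵀ * (R' * St * R') * U' := by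
          rw [hdd, ← one_add_eq_conj_diagonal hU2 hZ, h.conj_inv_conj]
      _ = (U'ᵀ * U') * (Matrix.diagonal fun i => 1 + lam i) * (U'ᵀ * U') := by
          rw [one_add_eq_conj_diagonal hU2' hZ']
          simp only [Matrix.mul_assoc]
      _ = _ := by rw [hU1', Matrix.one_mul, Matrix.mul_one]
  -- Invertibility of `T` makes its columns nonzero, so `1 + lam k > 0` with no smallness assumption
  -- on `lam`.
  have hTinv : (U'ᵀ * Q' * R * U * Matrix.diagonal fun i => (d i)⁻¹) * T = 1 := by
    have e : (Matrix.diagonal fun i => (d i)⁻¹) * Matrix.diagonal d = 1 := by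
      rw [Matrix.diagonal_mul_diagonal, ← Matrix.diagonal_one]
      congr 1
      funext i
      exact inv_mul_cancel₀ (hd0 i).ne'
    calc _ = U'ᵀ * (Q' * (R * (U * ((Matrix.diagonal fun i => (d i)⁻¹) * Matrix.diagonal d) * Uᵀ)
          * Q * R')) * U' := by rw [hT]; simp only [Matrix.mul_assoc]
      _ = 1 := by rw [e, Matrix.mul_one, hU2, Matrix.mul_one, h.inv_mul, Matrix.one_mul,
          h'.mul_inv, Matrix.mul_one, hU1']
  have hlam0 : ∀ k, 0 < 1 + lam k := fun k => by
    have e : 1 + lam k = ∑ i, T i k ^ 2 := by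
      have := congrFun (congrFun hTT k) k
      rw [Matrix.diagonal_apply_eq, Matrix.mul_apply] at this
      rw [← this]
      exact Finset.sum_congr rfl fun i _ => by rw [Matrix.transpose_apply, sq]
    have e0 : 0 ≤ ∑ i, T i k ^ 2 := Finset.sum_nonneg fun i _ => sq_nonneg _
    refine lt_of_le_of_ne (e ▸ e0) fun h0 => ?_
    rw [e, eq_comm, Finset.sum_eq_zero_iff_of_nonneg fun i _ => sq_nonneg _] at h0
    have := congrFun (congrFun hTinv k) k
    rw [Matrix.mul_apply, Matrix.one_apply_eq, Finset.sum_eq_zero fun i hi => by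
      rw [pow_eq_zero_iff two_ne_zero |>.mp (h0 i hi), mul_zero]] at this
    exact zero_ne_one this
  set f : Fin n → ℝ := fun i => (√(1 + lam i))⁻¹ with hf
  have hff : ∀ i, f i * f i * (1 + lam i) = 1 := fun i => by
    simp only [hf]
    rw [← mul_inv, Real.mul_self_sqrt (hlam0 i).le, inv_mul_cancel₀ (hlam0 i).ne']
  -- The orthogonal polar factor of `T`; it conjugates `Tᵀ T` into `T Tᵀ`.
  set W := T * Matrix.diagonal f with hWdef
  have hWW : Wᵀ * W = 1 := by
    rw [hWdef, Matrix.transpose_mul, Matrix.diagonal_transpose, Matrix.mul_assoc,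
      ← Matrix.mul_assoc Tᵀ, hTT, Matrix.diagonal_mul_diagonal, Matrix.diagonal_mul_diagonal,
      ← Matrix.diagonal_one]
    congr 1
    funext i
    linear_combination hff i
  have hW : W ∈ Matrix.orthogonalGroup (Fin n) ℝ := (Matrix.mem_orthogonalGroup_iff' _ _).mpr hWW
  have hW2 : W * Wᵀ = 1 := (Matrix.mem_orthogonalGroup_iff _ _).mp hW
  set G := Q * S'⁻¹ * Q with hG
  have hS'inv := h'.inv_eq
  have hG1 : (1 + (R * S' * R - 1)) * G = 1 := by
    rw [show 1 + (R * S' * R - 1) = R * S' * R by abel, hG, hS'inv, ← h'.mul_self,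
      show R * (Q' * Q') * R * (Q * (R' * R') * Q) = R * (Q' * (Q' * (R * (Q * (R' * (R' * Q)))))) by
        simp only [Matrix.mul_assoc], h.inv_mul_cancel, h'.mul_inv_cancel, h'.mul_inv_cancel,
      h.inv_mul]
  have hTTt : T * Tᵀ = Matrix.diagonal d * (Uᵀ * G * U) * Matrix.diagonal d := by
    rw [hTt, hT, hG, hS'inv]
    calc _ = Matrix.diagonal d * Uᵀ * Q * R' * (U' * U'ᵀ) * R' * Q * U * Matrix.diagonal d := by
          simp only [Matrix.mul_assoc]
      _ = _ := by
          rw [hU2', Matrix.mul_one]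
          simp only [Matrix.mul_assoc]
  have hdiff : W * Matrix.diagonal lam * Wᵀ - Matrix.diagonal μ =
      Matrix.diagonal d * (-(Uᵀ * (1 - G) * U)) * Matrix.diagonal d := by
    have e1 : W * (Matrix.diagonal fun i => 1 + lam i) * Wᵀ = T * Tᵀ := by
      have e : Matrix.diagonal f * (Matrix.diagonal fun i => 1 + lam i) * Matrix.diagonal f = 1 := by
        rw [Matrix.diagonal_mul_diagonal, Matrix.diagonal_mul_diagonal, ← Matrix.diagonal_one]
        congr 1
        funext i
        linear_combination hff i
      calc _ = T * (Matrix.diagonal f * (Matrix.diagonal fun i => 1 + lam i) * Matrix.diagonal f) *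
            Tᵀ := by
            rw [hWdef, Matrix.transpose_mul, Matrix.diagonal_transpose]
            simp only [Matrix.mul_assoc]
        _ = _ := by rw [e, Matrix.mul_one]
    have e2 : ∀ ν : Fin n → ℝ, Matrix.diagonal (fun i => 1 + ν i) = 1 + Matrix.diagonal ν :=
      fun ν => by rw [← Matrix.diagonal_one, Matrix.diagonal_add]
    rw [e2, Matrix.mul_add, Matrix.add_mul, Matrix.mul_one, hW2] at e1
    rw [e2] at hdd
    have e3 : W * Matrix.diagonal lam * Wᵀ - Matrix.diagonal μ =
        T * Tᵀ - Matrix.diagonal d * Matrix.diagonal d := by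
      rw [← e1, hdd]
      abel
    rw [e3, hTTt, Matrix.mul_sub, Matrix.sub_mul, Matrix.mul_one, hU1, neg_sub, Matrix.mul_sub,
      Matrix.sub_mul, Matrix.mul_one]
  refine (potential_le_add_frob hW lam μ).trans (add_le_add_right ?_ _)
  refine mul_le_of_le_one_right (Real.sqrt_nonneg _) ?_
  have hfr : frob (-(Uᵀ * (1 - G) * U)) = frob (1 - G) := by
    rw [frob_neg, frob_mul_right hU2, frob_mul_left (by simpa using hU2)]
  have hle := frob_inv_sub_one_le hG1 hS' (by norm_num : (11 : ℝ) / 100 < 1)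
  -- Here `0.11 / 0.89 < 1/2`, and conjugation by `diag(d)` costs at most a factor 2, so the
  -- perturbation has norm at most 1.
  have hle2 : frob (R * S' * R - 1) / (1 - 11 / 100) ≤ 1 / 2 := by
    rw [div_le_iff₀ (by norm_num)]
    linarith
  rw [hdiff]
  have hd1 : ∀ i, d i ≤ 101 / 100 := fun i =>
    Real.sqrt_le_iff.mpr ⟨by norm_num, by linarith [(hμ' i).2]⟩
  refine (frob_le_of_abs_le (Y := -(Uᵀ * (1 - G) * U)) (c := 2) (by norm_num)
    fun i j => ?_).trans (by rw [hfr]; linarith)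
  rw [Matrix.mul_diagonal, Matrix.diagonal_mul, abs_mul, abs_mul, abs_of_pos (hd0 i),
    abs_of_pos (hd0 j)]
  have hdij : d i * d j ≤ 2 := by nlinarith [hd1 i, hd1 j, hd0 i, hd0 j]
  nlinarith [mul_le_mul_of_nonneg_right hdij (abs_nonneg ((-(Uᵀ * (1 - G) * U)) i j))]

end Movement

/-! ### Fall of the potential in an update -/

section Update

variable {n : ℕ}

lemma sum_weight_sq_le (n : ℕ) : ∑ i : Fin n, weight i ^ 2 ≤ 1 + Real.log n := by
  have h : ∑ i : Fin n, weight i ^ 2 = (harmonic n : ℝ) := by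
    simp only [weight]
    rw [Fin.sum_univ_eq_sum_range (fun i : ℕ => (1 / √((i : ℝ) + 1)) ^ 2) n, harmonic]
    push_cast
    refine Finset.sum_congr rfl fun i _ => ?_
    rw [div_pow, Real.sq_sqrt (by positivity), one_pow, one_div]
  rw [h]
  exact harmonic_le_one_add_log n

lemma absEig_nonneg (lam : Fin n → ℝ) (π : Equiv.Perm (Fin n)) (j : ℕ) : 0 ≤ absEig lam π j := by
  unfold absEig
  split_ifs
  · exact abs_nonneg _
  · exact le_rfl

lemma absEig_succ (lam : Fin n → ℝ) (π : Equiv.Perm (Fin n)) (i : Fin n) :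
    absEig lam π (i + 1) = |lam (π i)| := by
  unfold absEig
  rw [dif_pos ⟨by omega, i.2⟩]
  rfl

lemma absEig_of_lt (lam : Fin n → ℝ) (π : Equiv.Perm (Fin n)) {j : ℕ} (hj : n < j) :
    absEig lam π j = 0 := by
  unfold absEig
  rw [dif_neg (by omega)]

variable {lam : Fin n → ℝ} {π : Equiv.Perm (Fin n)}

lemma absEig_anti (hs : Antitone fun i : Fin n => |lam (π i)|) {j k : ℕ} (hj : 1 ≤ j)
    (hjk : j ≤ k) : absEig lam π k ≤ absEig lam π j := by
  by_cases hk : k ≤ n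
  · unfold absEig
    rw [dif_pos ⟨by omega, hk⟩, dif_pos ⟨hj, by omega⟩]
    exact hs (Fin.mk_le_mk.mpr (by omega))
  · rw [absEig_of_lt lam π (by omega)]
    exact absEig_nonneg _ _ _

/-- As long as the guard holds the sorted eigenvalues decay slowly. -/
lemma absEig_ge_of_guard (hs : Antitone fun i : Fin n => |lam (π i)|)
    (hq : 0 ≤ 1 - 1 / Real.log n) (hlog : 0 ≤ Real.log n)
    (h1 : epsS < absEig lam π 1) {r : ℕ}
    (hr : ∀ j, 1 ≤ j → j < r → LoopGuard lam π j) (k : ℕ) :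
    ∀ j, 1 ≤ j → j ≤ r → j ≤ 2 ^ k → (1 - 1 / Real.log n) ^ k * epsS ≤ absEig lam π j := by
  have hε : 0 ≤ epsS := by norm_num [epsS]
  have hq1 : 1 - 1 / Real.log n ≤ 1 := by
    linarith [div_nonneg zero_le_one hlog]
  induction k with
  | zero =>
    intro j hj _ hj2
    obtain rfl : j = 1 := by rw [pow_zero] at hj2; omega
    simpa using h1.le
  | succ k ih =>
    intro j hj hjr hj2
    by_cases hj1 : j = 1
    · subst hj1
      exact (mul_le_of_le_one_left hε (pow_le_one₀ hq hq1)).trans h1.le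
    rw [pow_succ] at hj2
    -- The guard at `⌈j/2⌉` bounds position `2⌈j/2⌉`, which is at or just after `j`, so it also
    -- bounds position `j` by monotonicity.
    have hh := hr ((j + 1) / 2) (by omega) (by omega)
    have hle := absEig_anti hs hj (k := 2 * ((j + 1) / 2)) (by omega)
    refine le_trans ?_ hle
    rcases hh with hh | hh
    · exact (mul_le_of_le_one_left hε (pow_le_one₀ hq hq1)).trans hh.le
    · refine le_trans ?_ hh.le
      rw [pow_succ', mul_assoc]
      exact mul_le_mul_of_nonneg_left (ih _ (by omega) (by omega) (by omega)) hq

lemma two_le_log (hn : 8 ≤ n) : 2 ≤ Real.log n := by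
  have h8 : Real.log 8 = 3 * Real.log 2 := by
    rw [show (8 : ℝ) = 2 ^ 3 by norm_num, Real.log_pow]
    norm_num
  have : Real.log 8 ≤ Real.log n :=
    Real.log_le_log (by norm_num) (by exact_mod_cast hn)
  linarith [Real.log_two_gt_d9]

/-- For `x = 1 / log n ≤ 1/2` one has `log (1 - x) ≥ -2x`, and `⌈log₂ n⌉ ≤ log n / log 2 + 1 ≤ 2 log
n`. Both use `log n ≥ 2`, whence the requirement `8 ≤ n`. -/
lemma exp_neg_four_le_pow_clog (hn : 8 ≤ n) :
    Real.exp (-4) ≤ (1 - 1 / Real.log n) ^ Nat.clog 2 n := by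
  have hl := two_le_log hn
  set ℓ := Real.log n with hℓ
  have hx : 1 / ℓ ≤ 1 / 2 := one_div_le_one_div_of_le (by norm_num) hl
  have hq : 0 < 1 - 1 / ℓ := by linarith
  have hlogq : -(2 / ℓ) ≤ Real.log (1 - 1 / ℓ) := by
    refine le_trans ?_ (Real.one_sub_inv_le_log_of_pos hq)
    have : 1 - 1 / ℓ = (ℓ - 1) / ℓ := by field_simp
    rw [this, inv_div, neg_le_sub_iff_le_add, ← sub_nonneg]
    have : 1 + 2 / ℓ - ℓ / (ℓ - 1) = (ℓ - 2) / (ℓ * (ℓ - 1)) := by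
      field_simp [show ℓ - 1 ≠ 0 by linarith]
      ring
    rw [this]
    exact div_nonneg (by linarith) (mul_nonneg (by linarith) (by linarith))
  have hclog : (Nat.clog 2 n : ℝ) ≤ 2 * ℓ := by
    have h1 : 2 ^ (Nat.clog 2 n - 1) < n :=
      Nat.pow_pred_clog_lt_self (by norm_num) (by omega)
    have h2 : ((Nat.clog 2 n - 1 : ℕ) : ℝ) * Real.log 2 ≤ ℓ := by
      rw [← Real.log_pow]
      exact Real.log_le_log (by positivity) (by exact_mod_cast h1.le)
    have h3 : (Nat.clog 2 n : ℝ) ≤ ((Nat.clog 2 n - 1 : ℕ) : ℝ) + 1 := by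
      exact_mod_cast (by omega : Nat.clog 2 n ≤ Nat.clog 2 n - 1 + 1)
    nlinarith [Real.log_two_gt_d9]
  rw [← Real.exp_log (pow_pos hq _), Real.log_pow]
  refine Real.exp_le_exp.mpr ?_
  have h5 := mul_le_mul_of_nonneg_left hlogq (Nat.cast_nonneg (α := ℝ) (Nat.clog 2 n))
  have h6 : (Nat.clog 2 n : ℝ) * (2 / ℓ) ≤ 2 * ℓ * (2 / ℓ) :=
    mul_le_mul_of_nonneg_right hclog (by positivity)
  have h7 : 2 * ℓ * (2 / ℓ) = 4 := by field_simp; norm_num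
  linarith

/-- Each of the first `r` weights is at least `1/√r`. -/
lemma sqrt_le_sum_weight {r : ℕ} (hr : r ≤ n) :
    √(r : ℝ) ≤ ∑ i : Fin n, if (i : ℕ) < r then weight i else 0 := by
  have h : ∑ i : Fin n, (if (i : ℕ) < r then weight i else 0) =
      ∑ i ∈ Finset.range r, 1 / √((i : ℝ) + 1) := by
    simp only [weight]
    rw [Fin.sum_univ_eq_sum_range (fun i : ℕ => if i < r then 1 / √((i : ℝ) + 1) else 0) n,
      ← Finset.sum_filter]
    refine Finset.sum_congr ?_ fun _ _ => rfl
    ext i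
    simp only [Finset.mem_filter, Finset.mem_range]
    omega
  rw [h]
  rcases Nat.eq_zero_or_pos r with rfl | hr0
  · simp
  calc √(r : ℝ) = ∑ i ∈ Finset.range r, 1 / √(r : ℝ) := by
        rw [Finset.sum_const, Finset.card_range, nsmul_eq_mul, mul_one_div, Real.div_sqrt]
    _ ≤ _ := Finset.sum_le_sum fun i hi => by
        have : ((i : ℝ) + 1) ≤ r := by exact_mod_cast Finset.mem_range.mp hi
        gcongr

/-- Zeroing out the `2r` largest eigenvalues decreases the potential by `Ω(√r / log n)`. -/
lemma potential_newEig_add_le (hn : 8 ≤ n) (hs : Antitone fun i : Fin n => |lam (π i)|)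
    (h1 : epsS < absEig lam π 1) {r : ℕ}
    (hr : IsLeast {r : ℕ | 1 ≤ r ∧ ¬ LoopGuard lam π r} r) :
    √(r : ℝ) * (Real.exp (-4) * epsS / Real.log n) + potential (newEig lam π r) ≤
      potential lam ∧ ∀ k, |newEig lam π r k| ≤ epsS := by
  have hl := two_le_log hn
  have hx : 1 / Real.log n ≤ 1 / 2 := one_div_le_one_div_of_le (by norm_num) hl
  obtain ⟨⟨hr1, hg⟩, hmin⟩ := hr
  have hrn : r ≤ n := by
    -- The loop stops at `n` at the latest, since position `2n` carries the default value 0.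
    refine hmin ⟨by omega, fun hg => ?_⟩
    have hε : 0 ≤ epsS := by norm_num [epsS]
    have h0 := absEig_of_lt lam π (show n < 2 * n by omega)
    rcases hg with hg | hg
    · linarith
    · rw [h0] at hg
      exact absurd hg (not_lt.mpr (mul_nonneg (by linarith) (absEig_nonneg _ _ _)))
  have hguard : ∀ j, 1 ≤ j → j < r → LoopGuard lam π j := fun j hj hjr => by
    by_contra hc
    exact absurd (hmin ⟨hj, hc⟩) (by omega)
  have hlow : Real.exp (-4) * epsS ≤ absEig lam π r :=
    (mul_le_mul_of_nonneg_right (exp_neg_four_le_pow_clog hn) (by norm_num [epsS])).trans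
      (absEig_ge_of_guard hs (by linarith) (by linarith) h1 hguard (Nat.clog 2 n) r hr1 le_rfl
        (hrn.trans (Nat.le_pow_clog (by norm_num) n)))
  simp only [LoopGuard, not_or, not_lt] at hg
  set θ := absEig lam π (2 * r) with hθ
  have hθ0 : 0 ≤ θ := absEig_nonneg _ _ _
  set w : Fin n → ℝ := fun i => |newEig lam π r (π i)| with hw
  have hwi : ∀ i : Fin n, w i = if (i : ℕ) + 1 ≤ 2 * r then 0 else |lam (π i)| := fun i => by
    simp only [hw, newEig, Equiv.symm_apply_apply]
    split_ifs <;> simp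
  -- The sorted values capped at `θ` dominate the new values position by position. Being decreasing,
  -- they also bound every reordering of the new values, so the latter never need to be sorted
  -- again.
  set c : Fin n → ℝ := fun i => min |lam (π i)| θ with hc
  have hca : Antitone c := fun i j hij => min_le_min_right _ (hs hij)
  have hwc : ∀ i, w i ≤ c i := fun i => by
    rw [hwi]
    split_ifs with hi
    · exact le_min (abs_nonneg _) hθ0
    · refine le_min le_rfl ?_
      rw [← absEig_succ]
      exact absEig_anti hs (by omega) (by omega)
  constructor
  · have hnew : potential (newEig lam π r) ≤ ∑ i, weight i * c i := by
      refine potential_le fun σ => ?_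
      have e : ∀ i, |newEig lam π r (σ i)| = w ((σ.trans π.symm) i) := fun i => by
        simp [hw]
      calc ∑ i, weight i * |newEig lam π r (σ i)|
          ≤ ∑ i, weight i * c ((σ.trans π.symm) i) := Finset.sum_le_sum fun i _ => by
            rw [e]
            exact mul_le_mul_of_nonneg_left (hwc _) (weight_pos i).le
        _ ≤ ∑ i, weight i * c i :=
            (weight_antitone.monovary hca).sum_mul_comp_perm_le_sum_mul
    -- At the first `r` positions the cap removes at least `|λ_{π(r)}| - θ`, which the failed guard
    -- bounds below by `|λ_{π(r)}| / log n`.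
    have hdrop : ∀ i : Fin n, (if (i : ℕ) < r then weight i else 0) *
        (Real.exp (-4) * epsS / Real.log n) + weight i * c i ≤ weight i * |lam (π i)| := fun i => by
      split_ifs with hi
      · rw [← mul_add]
        refine mul_le_mul_of_nonneg_left ?_ (weight_pos i).le
        have h2 : absEig lam π r ≤ |lam (π i)| := by
          rw [← absEig_succ]
          exact absEig_anti hs (by omega) (by omega)
        have h3 : Real.exp (-4) * epsS / Real.log n ≤ absEig lam π r * (1 / Real.log n) := by
          rw [div_eq_mul_one_div]
          exact mul_le_mul_of_nonneg_right hlow (by positivity)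
        have h4 : c i ≤ θ := min_le_right _ _
        nlinarith [hg.2]
      · rw [zero_mul, zero_add]
        exact mul_le_mul_of_nonneg_left (min_le_left _ _) (weight_pos i).le
    have hsum := Finset.sum_le_sum fun (i : Fin n) (_ : i ∈ Finset.univ) => hdrop i
    rw [Finset.sum_add_distrib, ← Finset.sum_mul] at hsum
    have h5 := mul_le_mul_of_nonneg_right (sqrt_le_sum_weight hrn)
      (show 0 ≤ Real.exp (-4) * epsS / Real.log n by
        have : 0 ≤ epsS := by norm_num [epsS]
        positivity)
    linarith [le_potential lam π]
  · intro k
    have h6 : |newEig lam π r k| = w (π.symm k) := by simp [hw]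
    rw [h6]
    exact (hwc _).trans ((min_le_right _ _).trans hg.1)

/-- The diagonal factor is supported on the sorted positions `1, …, 2r`. -/
lemma rank_update_le {X Y U : Matrix (Fin n) (Fin n) ℝ} {r : ℕ} :
    (X * U * Matrix.diagonal (newEig lam π r - lam) * Uᵀ * Y).rank ≤ 2 * r := by
  refine (Matrix.rank_mul_le_left _ _).trans ((Matrix.rank_mul_le_left _ _).trans
    ((Matrix.rank_mul_le_right _ _).trans ?_))
  rw [Matrix.rank_diagonal, ← Fintype.card_fin (2 * r)]
  refine Fintype.card_le_of_injective
    (fun k => ⟨(π.symm k.1 : ℕ), ?_⟩) fun a b hab => ?_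
  · by_contra hlt
    apply k.2
    rw [Pi.sub_apply, newEig, if_neg (by omega), sub_self]
  · simp only [Fin.mk.injEq] at hab
    exact Subtype.ext (π.symm.injective (Fin.ext hab))

end Update

/-! ### Amortisation over a run -/

section Run

variable {n m : ℕ} {P : SDPData n m} {εN : ℝ}

/-- One iteration of the interior point method keeps the iterates near the central path and the
approximate slack matrix close to the true one, and the square root of the rank of the update is
paid for by the potential. -/
lemma IPMStep.invariant (hn : 8 ≤ n) (hP : P.NoRedundantConstraints) (hε : 0 < εN)
    (hε1 : εN ≤ 1 / 10) {s s' : IPMState n m} (hs : IPMStep P εN s s')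
    (hnear : P.NearCentralPath εN s.η s.y) {U : Matrix (Fin n) (Fin n) ℝ} {μ : Fin n → ℝ}
    (hU : U ∈ Matrix.orthogonalGroup (Fin n) ℝ)
    (hZ : (CFC.sqrt (P.slack s.y))⁻¹ * s.St * (CFC.sqrt (P.slack s.y))⁻¹ - 1 =
      U * Matrix.diagonal μ * Uᵀ) (hμ : ∀ i, |μ i| ≤ 1 / 100) :
    P.NearCentralPath εN s'.η s'.y ∧ ∃ U' ∈ Matrix.orthogonalGroup (Fin n) ℝ, ∃ μ' : Fin n → ℝ,
      (CFC.sqrt (P.slack s'.y))⁻¹ * s'.St * (CFC.sqrt (P.slack s'.y))⁻¹ - 1 =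
        U' * Matrix.diagonal μ' * U'ᵀ ∧ (∀ i, |μ' i| ≤ 1 / 100) ∧
      √((s'.St - s.St).rank : ℝ) * (Real.exp (-4) * epsS / (2 * Real.log n)) + potential μ' ≤
        potential μ + √(1 + Real.log n) := by
  have h := SymmSqrt.of_posDef hnear.1
  have hg := SDPData.gradient_increase hε hε1 (by omega) h
    ((SDPData.nearCentralPath_iff hP hε.le h).mp hnear).2
  rw [← hs.eta_new] at hg
  obtain ⟨hnear', hmove⟩ := SDPData.newton_step hP hε hε1 h hU hZ hμ hg hs.y_new
  refine ⟨hnear', ?_⟩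
  have h' := SymmSqrt.of_posDef hnear'.1
  obtain ⟨U', hU', lam, π, hZ', hsort, hcase⟩ := hs.St_new
  have hpot := (potential_le_of_move h h' hmove hU hU' hZ hμ hZ').trans
    (add_le_add_right (Real.sqrt_le_sqrt (sum_weight_sq_le n)) _)
  refine ⟨U', hU', ?_⟩
  rcases hcase with ⟨h1, hSt⟩ | ⟨h1, r, hr, hSt⟩
  · refine ⟨lam, by rw [hSt]; exact hZ', fun k => ?_, ?_⟩
    · refine le_trans ?_ h1
      rw [← π.apply_symm_apply k, ← absEig_succ]
      exact absEig_anti hsort le_rfl (by omega)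
    · rw [hSt, sub_self, Matrix.rank_zero]
      simpa using hpot
  -- The update is diagonal in the eigenbasis `U'`, so the same `U'` diagonalises the new error,
  -- with spectrum `newEig lam π r`.
  · obtain ⟨hdrop, hsmall⟩ := potential_newEig_add_le hn hsort h1 hr
    have hU2 : U'ᵀ * U' = 1 := (Matrix.mem_orthogonalGroup_iff' _ _).mp hU'
    refine ⟨newEig lam π r, ?_, hsmall, ?_⟩
    · rw [hSt, Matrix.mul_add, Matrix.add_mul, add_sub_right_comm, hZ',
        show CFC.sqrt (P.slack s'.y) * U' * Matrix.diagonal (newEig lam π r - lam) * U'ᵀ *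
          CFC.sqrt (P.slack s'.y) = CFC.sqrt (P.slack s'.y) *
            (U' * Matrix.diagonal (newEig lam π r - lam) * U'ᵀ) * CFC.sqrt (P.slack s'.y) by
          simp only [Matrix.mul_assoc], h'.inv_conj_conj, ← Matrix.add_mul, ← Matrix.mul_add,
        Matrix.diagonal_add]
      congr 3
      funext k
      simp
    · have hrank : √((s'.St - s.St).rank : ℝ) ≤ 2 * √(r : ℝ) := by
        have hle : (s'.St - s.St).rank ≤ 2 * r := by
          rw [hSt, add_sub_cancel_left]
          exact rank_update_le
        rw [Real.sqrt_le_left (by positivity), mul_pow, Real.sq_sqrt (Nat.cast_nonneg r)]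
        have : ((s'.St - s.St).rank : ℝ) ≤ 2 * r := by exact_mod_cast hle
        linarith [(Nat.cast_nonneg r : (0 : ℝ) ≤ r)]
      have hl := two_le_log hn
      have hc : 0 ≤ Real.exp (-4) * epsS / (2 * Real.log n) := by
        have : 0 ≤ epsS := by norm_num [epsS]
        positivity
      have h2 := mul_le_mul_of_nonneg_right hrank hc
      have h3 : 2 * √(r : ℝ) * (Real.exp (-4) * epsS / (2 * Real.log n)) =
          √(r : ℝ) * (Real.exp (-4) * epsS / Real.log n) := by
        field_simp
      linarith

/-- The potential pays for the ranks of all updates of a run. -/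
lemma IsIPMRun.sum_sqrt_rank_le (hn : 8 ≤ n) (hP : P.NoRedundantConstraints) (hε : 0 < εN)
    (hε1 : εN ≤ 1 / 10) {δ η₀ : ℝ} {y₀ : Fin m → ℝ} (hnear : P.NearCentralPath εN η₀ y₀)
    {s : ℕ → IPMState n m} (hs : IsIPMRun P δ εN η₀ y₀ s) :
    (∑ i ∈ Finset.range (numIterations n δ εN), √(updateRank s (i + 1) : ℝ)) *
      (Real.exp (-4) * epsS / (2 * Real.log n)) ≤
        numIterations n δ εN * √(1 + Real.log n) := by
  have key : ∀ t ≤ numIterations n δ εN, P.NearCentralPath εN (s t).η (s t).y ∧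
      ∃ U ∈ Matrix.orthogonalGroup (Fin n) ℝ, ∃ μ : Fin n → ℝ,
      (CFC.sqrt (P.slack (s t).y))⁻¹ * (s t).St * (CFC.sqrt (P.slack (s t).y))⁻¹ - 1 =
        U * Matrix.diagonal μ * Uᵀ ∧ (∀ i, |μ i| ≤ 1 / 100) ∧
      (∑ i ∈ Finset.range t, √(updateRank s (i + 1) : ℝ)) *
        (Real.exp (-4) * epsS / (2 * Real.log n)) + potential μ ≤ t * √(1 + Real.log n) := by
    intro t
    induction t with
    | zero =>
      intro _
      rw [hs.eta_init, hs.y_init, hs.St_init]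
      refine ⟨hnear, 1, one_mem _, 0, ?_, fun i => by norm_num, ?_⟩
      · rw [(SymmSqrt.of_posDef hnear.1).inv_conj_self]
        simp
      · simp [potential_zero]
    | succ t ih =>
      intro ht
      obtain ⟨hnt, U, hU, μ, hZ, hμ, hsum⟩ := ih (by omega)
      obtain ⟨hnt', U', hU', μ', hZ', hμ', hstep⟩ :=
        (hs.step t (by omega)).invariant hn hP hε hε1 hnt hU hZ hμ
      refine ⟨hnt', U', hU', μ', hZ', hμ', ?_⟩
      rw [Finset.sum_range_succ, add_mul]
      push_cast
      have : updateRank s (t + 1) = ((s (t + 1)).St - (s t).St).rank := rfl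
      rw [this]
      linarith
  obtain ⟨-, _, -, μ, -, -, h⟩ := key _ le_rfl
  linarith [potential_nonneg μ]

/-- This absorbs the term `√r_0 = √n`, and it makes `T` large enough to absorb additive constants.
-/
lemma sqrt_le_numIterations {δ : ℝ} (hn : 2 ≤ n) (hδ : 0 < δ) (hδ1 : δ ≤ 1 / 10) (hε : 0 < εN)
    (hε1 : εN ≤ 1 / 10) : 200 * √(n : ℝ) ≤ numIterations n δ εN := by
  refine le_trans ?_ (Nat.le_ceil _)
  have hn2 : (2 : ℝ) ≤ n := by exact_mod_cast hn
  have h1 : 400 ≤ 40 / εN := by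
    rw [le_div_iff₀ hε]
    linarith
  have h2 : 2 ≤ (n : ℝ) / δ := by
    rw [le_div_iff₀ hδ]
    nlinarith
  have h3 : 1 / 2 ≤ Real.log (n / δ) := by
    have h4 := Real.log_le_log (by norm_num) h2
    linarith [Real.log_two_gt_d9]
  have h5 : 0 ≤ √(n : ℝ) := Real.sqrt_nonneg _
  calc 200 * √(n : ℝ) = 400 * √(n : ℝ) * (1 / 2) := by ring
    _ ≤ 40 / εN * √(n : ℝ) * Real.log (n / δ) := by gcongr

lemma rpow_three_halves {x : ℝ} (hx : 0 < x) : x ^ (3 / 2 : ℝ) = x * √x := by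
  rw [show (3 / 2 : ℝ) = 1 + 1 / 2 by norm_num, Real.rpow_add hx, Real.rpow_one,
    Real.sqrt_eq_rpow]

lemma half_le_log_rpow (hn : 2 ≤ n) : 1 / 2 ≤ Real.log n ^ (3 / 2 : ℝ) := by
  have h1 : Real.log 2 ≤ Real.log n := Real.log_le_log (by norm_num) (by exact_mod_cast hn)
  have h2 : 64 / 100 ≤ Real.log n := by linarith [Real.log_two_gt_d9]
  have h3 : 8 / 10 ≤ √(Real.log n) := Real.le_sqrt_of_sq_le (by linarith)
  rw [rpow_three_halves (by linarith)]
  nlinarith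

/-- The rank inequality for runs that start near the central path. -/
theorem IsIPMRun.rank_inequality (hn : 2 ≤ n) (hP : P.NoRedundantConstraints) {δ : ℝ}
    (hδ : 0 < δ) (hδ1 : δ ≤ 1 / 10) (hε : 0 < εN) (hε1 : εN ≤ 1 / 10) {η₀ : ℝ} {y₀ : Fin m → ℝ}
    (hnear : P.NearCentralPath εN η₀ y₀) {s : ℕ → IPMState n m}
    (hs : IsIPMRun P δ εN η₀ y₀ s) :
    ∑ i ∈ Finset.range (numIterations n δ εN + 1), √(updateRank s i : ℝ) ≤
      (400 * Real.exp 4 + 12) * (numIterations n δ εN * Real.log n ^ (3 / 2 : ℝ)) := by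
  have hT := sqrt_le_numIterations hn hδ hδ1 hε hε1
  have hlog := half_le_log_rpow hn
  have hn2 : (2 : ℝ) ≤ n := by exact_mod_cast hn
  have hsq : 1 ≤ √(n : ℝ) := Real.one_le_sqrt.mpr (by linarith)
  set T := numIterations n δ εN with hTdef
  have hT0 : (0 : ℝ) ≤ T := Nat.cast_nonneg T
  have hTl : (T : ℝ) * (1 / 2) ≤ T * Real.log n ^ (3 / 2 : ℝ) :=
    mul_le_mul_of_nonneg_left hlog hT0
  have hexp := Real.exp_pos 4
  by_cases hn8 : 8 ≤ n
  · have hmain := hs.sum_sqrt_rank_le hn8 hP hε hε1 hnear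
    rw [← hTdef] at hmain
    rw [Finset.sum_range_succ']
    have h0 : updateRank s 0 = n := rfl
    rw [h0]
    set total := ∑ i ∈ Finset.range T, √(updateRank s (i + 1) : ℝ)
    have hl := two_le_log hn8
    set ℓ := Real.log n
    have h1 : √(1 + ℓ) ≤ 2 * √ℓ := by
      rw [Real.sqrt_le_left (by positivity), mul_pow, Real.sq_sqrt (by linarith)]
      linarith
    -- The factor `200 e⁴ ℓ` inverts the price per unit of `√r_i`, as `epsS = 1/100`; the bound `√(1
    -- + ℓ) ≤ 2 √ℓ` doubles it to 400.
    have h2 : total = total * (Real.exp (-4) * epsS / (2 * ℓ)) * (200 * Real.exp 4 * ℓ) := by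
      rw [Real.exp_neg, epsS]
      field_simp
      ring
    have h3 : total ≤ 400 * Real.exp 4 * (T * ℓ ^ (3 / 2 : ℝ)) := by
      rw [h2, rpow_three_halves (by linarith)]
      calc _ ≤ T * √(1 + ℓ) * (200 * Real.exp 4 * ℓ) := by gcongr
        _ ≤ T * (2 * √ℓ) * (200 * Real.exp 4 * ℓ) := by gcongr
        _ = _ := by ring
    linarith
  -- For `n < 8` every rank is at most 9, so the sum is at most `3 (T + 1) ≤ 6 T`. As `log^{1.5} n ≥
  -- 1/2`, this is at most `12 T log^{1.5} n`.
  · have hle : ∀ i ∈ Finset.range (T + 1), √(updateRank s i : ℝ) ≤ 3 := fun i _ => by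
      have h1 : updateRank s i ≤ n := by
        cases i with
        | zero => exact le_rfl
        | succ i => exact (Matrix.rank_le_width _)
      have h2 : (updateRank s i : ℝ) ≤ 9 := by exact_mod_cast (by omega : updateRank s i ≤ 9)
      exact Real.sqrt_le_iff.mpr ⟨by norm_num, by linarith⟩
    have h1 := Finset.sum_le_card_nsmul _ _ _ hle
    rw [Finset.card_range, nsmul_eq_mul] at h1
    push_cast at h1
    have h2 : 0 ≤ 400 * Real.exp 4 * (T * Real.log n ^ (3 / 2 : ℝ)) := by positivity
    linarith

end Run

/-! ### The start of the modified program -/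

section Modified

variable {n m : ℕ}

lemma blockDiag_castAdd (M : Matrix (Fin n) (Fin n) ℝ) (u v : ℝ) (i j : Fin n) :
    blockDiag M u v (Fin.castAdd 2 i) (Fin.castAdd 2 j) = M i j := by
  simp [blockDiag]

lemma blockDiag_castAdd_natAdd (M : Matrix (Fin n) (Fin n) ℝ) (u v : ℝ) (i : Fin n) (j : Fin 2) :
    blockDiag M u v (Fin.castAdd 2 i) (Fin.natAdd n j) = 0 := by
  simp [blockDiag]

lemma blockDiag_natAdd_castAdd (M : Matrix (Fin n) (Fin n) ℝ) (u v : ℝ) (i : Fin 2) (j : Fin n) :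
    blockDiag M u v (Fin.natAdd n i) (Fin.castAdd 2 j) = 0 := by
  simp [blockDiag]

lemma blockDiag_natAdd (M : Matrix (Fin n) (Fin n) ℝ) (u v : ℝ) (i j : Fin 2) :
    blockDiag M u v (Fin.natAdd n i) (Fin.natAdd n j) = Matrix.diagonal ![u, v] i j := by
  simp [blockDiag]

lemma trace_blockDiag (M : Matrix (Fin n) (Fin n) ℝ) (u v : ℝ) :
    (blockDiag M u v).trace = M.trace + (u + v) := by
  rw [Matrix.trace, Fin.sum_univ_add]
  simp [blockDiag_castAdd, blockDiag_natAdd, Matrix.trace]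

lemma frob_blockDiag_zero (M : Matrix (Fin n) (Fin n) ℝ) : frob (blockDiag M 0 0) = frob M := by
  rw [frob, frob]
  congr 1
  simp [Fin.sum_univ_add, blockDiag_castAdd, blockDiag_natAdd, blockDiag_castAdd_natAdd,
    blockDiag_natAdd_castAdd]

lemma blockDiag_sub_sub_one (M : Matrix (Fin n) (Fin n) ℝ) :
    blockDiag 1 1 0 - blockDiag M 0 (-1) - 1 = blockDiag (-M) 0 0 := by
  ext i j
  refine Fin.addCases (fun i => ?_) (fun i => ?_) i <;>
    refine Fin.addCases (fun j => ?_) (fun j => ?_) j <;>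
    simp only [Matrix.sub_apply, blockDiag_castAdd, blockDiag_natAdd, blockDiag_castAdd_natAdd,
      blockDiag_natAdd_castAdd, Matrix.one_apply, Fin.castAdd_inj, Matrix.neg_apply]
  · ring
  · rw [if_neg (by simp [Fin.ext_iff]; omega)]; ring
  · rw [if_neg (by simp [Fin.ext_iff]; omega)]; ring
  · fin_cases i <;> fin_cases j <;> simp [Fin.ext_iff]

/-- Each column is the image of a unit vector, so its norm is at most the operator norm. -/
lemma frob_le_sqrt_mul_opNorm (M : Matrix (Fin n) (Fin n) ℝ) :
    frob M ≤ √n * ‖Matrix.toEuclideanCLM (𝕜 := ℝ) M‖ := by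
  rw [← sq_le_sq₀ (frob_nonneg _) (by positivity), mul_pow, Real.sq_sqrt (Nat.cast_nonneg n),
    frob_sq, Finset.sum_comm]
  have hcol : ∀ j, ∑ i, M i j ^ 2 ≤ ‖Matrix.toEuclideanCLM (𝕜 := ℝ) M‖ ^ 2 := fun j => by
    have h := (Matrix.toEuclideanCLM (𝕜 := ℝ) M).le_opNorm (EuclideanSpace.single j 1)
    rw [PiLp.norm_single, norm_one, mul_one] at h
    have h2 := pow_le_pow_left₀ (norm_nonneg _) h 2
    rw [EuclideanSpace.norm_sq_eq] at h2
    refine le_of_eq_of_le (Finset.sum_congr rfl fun i _ => ?_) h2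
    rw [Real.norm_eq_abs, sq_abs, EuclideanSpace.single, Matrix.toEuclideanCLM_toLp]
    simp
  refine (Finset.sum_le_sum fun j _ => hcol j).trans ?_
  simp

namespace SDPData

variable (P : SDPData n m) (δ R L : ℝ)

lemma modified_noRedundantConstraints (hP : P.NoRedundantConstraints) :
    (P.modified δ R L).NoRedundantConstraints := by
  rw [NoRedundantConstraints, Fintype.linearIndependent_iff]
  intro g hg
  rw [Fin.sum_univ_castSucc] at hg
  simp only [modified, Fin.snoc_castSucc, Fin.snoc_last] at hg
  have hlast : g (Fin.last m) = 0 := by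
    have := congrFun (congrFun hg (Fin.natAdd n 0)) (Fin.natAdd n 0)
    simpa [Matrix.add_apply, Matrix.sum_apply, Matrix.smul_apply, blockDiag_natAdd] using this
  have hinit : ∑ i : Fin m, g i.castSucc • P.A i = 0 := by
    ext i j
    have := congrFun (congrFun hg (Fin.castAdd 2 i)) (Fin.castAdd 2 j)
    simpa [Matrix.add_apply, Matrix.sum_apply, Matrix.smul_apply, blockDiag_castAdd, hlast]
      using this
  have h0 := Fintype.linearIndependent_iff.mp hP _ hinit
  exact Fin.lastCases hlast h0

lemma modified_slack_sub_one :
    (P.modified δ R L).slack (modifiedStart m) - 1 = blockDiag (-((δ / L) • P.C)) 0 0 := by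
  rw [← blockDiag_sub_sub_one, slack, Fin.sum_univ_castSucc]
  simp [modified, modifiedStart]

/-- Hence the identity matrix is the exact central-path slack at `η = 1`: the gradient there would
be `tr[Ā_j] - tr[Ā_j] = 0`. -/
lemma modified_b (j : Fin (m + 1)) :
    (P.modified δ R L).b j = ((P.modified δ R L).A j).trace := by
  refine Fin.lastCases ?_ (fun i => ?_) j
  · simp [modified, trace_blockDiag]
  · simp [modified, trace_blockDiag]

variable {P δ L}

/-- The initial solution of the modified program is near the central path at `η = 1`. -/
lemma modifiedStart_near (hP : P.NoRedundantConstraints) (hL : 0 < L)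
    (hC : ‖Matrix.toEuclideanCLM (𝕜 := ℝ) P.C‖ ≤ L) (hδ : 0 < δ) {εN : ℝ} (hε1 : εN ≤ 1 / 10)
    (hδε : δ * √(n : ℝ) ≤ εN) :
    (P.modified δ R L).NearCentralPath εN 1 (modifiedStart m) := by
  have hε0 : 0 ≤ εN := le_trans (by positivity) hδε
  set P' := P.modified δ R L with hP'
  set S := P'.slack (modifiedStart m) with hS
  have hfrob : frob (S - 1) ≤ εN := by
    rw [hS, hP', modified_slack_sub_one, frob_blockDiag_zero, frob_neg]
    refine (frob_le_of_abs_le (Y := P.C) (c := δ / L) (by positivity) fun i j => ?_).trans ?_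
    · rw [Matrix.smul_apply, smul_eq_mul, abs_mul, abs_of_pos (by positivity)]
    · have h1 := (frob_le_sqrt_mul_opNorm P.C).trans
        (mul_le_mul_of_nonneg_left hC (Real.sqrt_nonneg _))
      calc δ / L * frob P.C ≤ δ / L * (√n * L) := by gcongr
        _ = δ * √n := by field_simp
        _ ≤ εN := hδε
  have h1 : SymmSqrt (1 : Matrix (Fin (n + 2)) (Fin (n + 2)) ℝ) 1 1 := by
    constructor <;> simp
  have hpd : S.PosDef := by
    refine h1.posDef_of_frob_lt_one (P'.slack_symm _) ?_
    rw [Matrix.one_mul, Matrix.mul_one]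
    linarith
  have h := SymmSqrt.of_posDef hpd
  rw [nearCentralPath_iff (P.modified_noRedundantConstraints δ R L hP) hε0 h]
  refine ⟨hpd, fun v => ?_⟩
  set Q := CFC.sqrt S
  have hb : P'.b ⬝ᵥ v = (P'.comb v).trace := by
    rw [comb, Matrix.trace_sum, dotProduct]
    refine Finset.sum_congr rfl fun j _ => ?_
    rw [Matrix.trace_smul, smul_eq_mul, modified_b, mul_comm]
  -- Since `b̄_j = tr Ā_j`, the gradient is `tr[(I - S⁻¹) Ā_j]`. Written in local coordinates it is
  -- represented by `S - I`, whose norm is at most `δ √n ≤ εN`.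
  have he : P'.gradient 1 (modifiedStart m) ⬝ᵥ v = ((S - 1) * (Q⁻¹ * P'.comb v * Q⁻¹)).trace := by
    rw [gradient_dotProduct, ← hS, one_mul, hb, Matrix.sub_mul, Matrix.one_mul, Matrix.trace_sub,
      h.inv_eq]
    congr 1
    · rw [← h.mul_self, Matrix.mul_assoc, Matrix.mul_assoc Q⁻¹, h.mul_inv_cancel,
        Matrix.trace_mul_comm, Matrix.mul_assoc, h.inv_mul, Matrix.mul_one]
    · rw [Matrix.mul_assoc, Matrix.trace_mul_comm]
  rw [he]
  exact (abs_trace_mul_le _ _).trans (mul_le_mul_of_nonneg_right hfrob (frob_nonneg _))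

end SDPData

end Modified

end

theorem theorem6p1 :
    ∃ K : ℝ, 0 < K ∧
      -- runs on an arbitrary program from an arbitrary start near the central path
      (∀ (n m : ℕ) (P : SDPData n m) (δ εN η₀ : ℝ) (y₀ : Fin m → ℝ) (s : ℕ → IPMState n m),
        2 ≤ n → P.NoRedundantConstraints →
        0 < δ → δ ≤ 1 / 10 → 0 < εN → εN ≤ 1 / 10 → 0 < η₀ →
        P.NearCentralPath εN η₀ y₀ →
        IsIPMRun P δ εN η₀ y₀ s →
        ∑ i ∈ Finset.range (numIterations n δ εN + 1), √(updateRank s i : ℝ) ≤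
          K * (numIterations n δ εN * Real.log n ^ (3 / 2 : ℝ))) ∧
      -- runs on the modified program from its explicit initial solution
      (∀ (n m : ℕ) (P : SDPData n m) (δ εN R L : ℝ) (s : ℕ → IPMState (n + 2) (m + 1)),
        P.NoRedundantConstraints →
        0 < R → 0 < L → ‖Matrix.toEuclideanCLM (𝕜 := ℝ) P.C‖ ≤ L →
        0 < δ → δ ≤ 1 / 10 → 0 < εN → εN ≤ 1 / 10 → δ * √(n : ℝ) ≤ εN →
        IsIPMRun (P.modified δ R L) δ εN 1 (modifiedStart m) s →
        ∑ i ∈ Finset.range (numIterations (n + 2) δ εN + 1), √(updateRank s i : ℝ) ≤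
          K * (numIterations (n + 2) δ εN * Real.log (n + 2) ^ (3 / 2 : ℝ))) := by

  refine ⟨400 * Real.exp 4 + 12, by positivity, ?_, ?_⟩
  · intro n m P δ εN η₀ y₀ s hn hP hδ hδ1 hε hε1 _ hnear hs
    exact hs.rank_inequality hn hP hδ hδ1 hε hε1 hnear
  · intro n m P δ εN R L s hP _ hL hC hδ hδ1 hε hε1 hδε hs
    have h := hs.rank_inequality (by omega) (P.modified_noRedundantConstraints δ R L hP) hδ hδ1
      hε hε1 (SDPData.modifiedStart_near R hP hL hC hδ hε1 hδε)
    push_cast at h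
    exact h
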